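/- Let $\mathfrak g$ be a complex classical simple Lie algebra, that is, a simple complex Lie algebra isomorphic to $\mathfrak{sl}(n,\mathbb C)$, $\mathfrak{so}(n,\mathbb C)$ or $\mathfrak{sp}(2n,\mathbb C)$ for some $n$. Let $\mathfrak g_0$ be a split real form of $\mathfrak g$ (a real Lie algebra with $\mathbb C\otimes_{\mathbb R}\mathfrak g_0\cong\mathfrak g$ that has a Cartan subalgebra $\mathfrak h$ all of whose elements act on $\mathfrak g_0$ by endomorphisms that are triangularizable over $\mathbb R$, called a splitting Cartan subalgebra). Let $\mathfrak p$ be a minimal parabolic subalgebra of $\mathfrak g_0$, that is, $\mathfrak p=\mathfrak h\oplus\bigoplus_{\alpha\in\triangle^+}(\mathfrak g_0)_\alpha$ for some splitting Cartan subalgebra $\mathfrak h$ of $\mathfrak g_0$ and some system $\triangle^+$ of positive roots of $(\mathfrak g_0,\mathfrak h)$. Let $\mathfrak n$ be the nilradical (the largest nilpotent ideal) of $\mathfrak p$. Let $s\ge 0$ be an integer such that the trivial extension $\mathbb R^s\oplus\mathfrak n$ (the product of $\mathfrak n$ with the abelian Lie algebra $\mathbb R^s$) has even dimension. Then $\mathbb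 R^s\oplus\mathfrak n$ admits a symplectic structure, that is, a non-degenerate skew-symmetric bilinear form $\omega$ with $$\omega([x,y],z)-\omega([x,z],y)+\omega([y,z],x)=0\qquad\text{for all }x,y,z\in\mathbb R^s\oplus\mathfrak n,$$ if and only if $\mathfrak g$ is isomorphic to one of $$\mathfrak{sl}(2,\mathbb C),\qquad \mathfrak{sl}(3,\mathbb C),\qquad \mathfrak{so}(5,\mathbb C).$$ -/

import Mathlib

open scoped TensorProduct

/-- A symplectic structure on a real Lie algebra `L`: a skew-symmetric bilinear form `ω` that is
closed for the Chevalley-Eilenberg differential,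
`dω (x, y, z) = ω ([x, y], z) - ω ([x, z], y) + ω ([y, z], x) = 0`, and non-degenerate. -/
structure IsSymplecticForm {L : Type*} [LieRing L] [LieAlgebra ℝ L]
    (ω : LinearMap.BilinForm ℝ L) : Prop where
  alt : ω.IsAlt
  closed : ∀ x y z : L, ω ⁅x, y⁆ z - ω ⁅x, z⁆ y + ω ⁅y, z⁆ x = 0
  nondegenerate : ω.Nondegenerate

/-- The Lie algebra `L` admits a symplectic structure. -/
def AdmitsSymplectic (L : Type*) [LieRing L] [LieAlgebra ℝ L] : Prop :=
  ∃ ω : LinearMap.BilinForm ℝ L, IsSymplecticForm ω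

/-- Complex classical simple Lie algebras: the simple Lie algebras isomorphic to one of
`sl(n, ℂ)`, `so(n, ℂ)`, `sp(2n, ℂ)`. Simplicity excludes the low-dimensional degenerate cases
(such as `so(2, ℂ)` and `so(4, ℂ)`). -/
def IsClassicalSimple (𝔤 : Type*) [LieRing 𝔤] [LieAlgebra ℂ 𝔤] : Prop :=
  LieAlgebra.IsSimple ℂ 𝔤 ∧
    ((∃ n : ℕ, Nonempty (𝔤 ≃ₗ⁅ℂ⁆ LieAlgebra.SpecialLinear.sl (Fin n) ℂ)) ∨
      (∃ n : ℕ, Nonempty (𝔤 ≃ₗ⁅ℂ⁆ LieAlgebra.Orthogonal.so (Fin n) ℂ)) ∨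
      (∃ n : ℕ, Nonempty (𝔤 ≃ₗ⁅ℂ⁆ LieAlgebra.Symplectic.sp (Fin n) ℂ)))

/-- A splitting Cartan subalgebra `𝔥` of a real Lie algebra `𝔤₀`: a Cartan subalgebra such that
all `ad x`, `x ∈ 𝔥`, are triangularizable over `ℝ`. -/
structure IsSplittingCartan {𝔤₀ : Type*} [LieRing 𝔤₀] [LieAlgebra ℝ 𝔤₀]
    (𝔥 : LieSubalgebra ℝ 𝔤₀) : Prop where
  cartan : 𝔥.IsCartanSubalgebra
  split : LieModule.IsTriangularizable ℝ 𝔥 𝔤₀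

/-- `𝔤₀` is a split real form of the complex Lie algebra `𝔤`: its complexification is isomorphic
to `𝔤`, and it has a splitting Cartan subalgebra. -/
def IsSplitRealForm (𝔤₀ : Type*) [LieRing 𝔤₀] [LieAlgebra ℝ 𝔤₀]
    (𝔤 : Type*) [LieRing 𝔤] [LieAlgebra ℂ 𝔤] : Prop :=
  Nonempty ((ℂ ⊗[ℝ] 𝔤₀) ≃ₗ⁅ℂ⁆ 𝔤) ∧ ∃ 𝔥 : LieSubalgebra ℝ 𝔤₀, IsSplittingCartan 𝔥

/-- Minimal parabolic (equivalently, Borel) subalgebras of a split real Lie algebra: there are a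
splitting Cartan subalgebra `𝔥` and a system of positive roots, namely the roots that are positive
at some regular `x ∈ 𝔥` (a point of an open Weyl chamber), such that `𝔭` is the sum of `𝔥` and the
positive root spaces. -/
def IsMinimalParabolic {𝔤₀ : Type*} [LieRing 𝔤₀] [LieAlgebra ℝ 𝔤₀]
    (𝔭 : LieSubalgebra ℝ 𝔤₀) : Prop :=
  ∃ (𝔥 : LieSubalgebra ℝ 𝔤₀) (h : IsSplittingCartan 𝔥) (x : 𝔥),
    haveI := h.cartan
    (∀ α : LieModule.Weight ℝ 𝔥 𝔤₀, α.IsNonZero → α x ≠ 0) ∧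
      𝔭.toSubmodule = 𝔥.toSubmodule ⊔
        ⨆ (α : LieModule.Weight ℝ 𝔥 𝔤₀) (_ : 0 < α x),
          (LieAlgebra.rootSpace 𝔥 α).toSubmodule

/-- The nilradical: the largest ideal which is nilpotent as a Lie algebra. (Mathlib's
`LieAlgebra.maxNilpotentIdeal` asks instead that the whole algebra act nilpotently on the ideal,
which is a different notion.) -/
def lieNilradical (L : Type*) [LieRing L] [LieAlgebra ℝ L] : LieIdeal ℝ L :=
  sSup {I : LieIdeal ℝ L | LieRing.IsNilpotent I}

/-- The abelian real Lie algebra `ℝ^s`. -/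
def AbelianLie (s : ℕ) : Type := Fin s → ℝ

noncomputable instance (s : ℕ) : AddCommGroup (AbelianLie s) :=
  inferInstanceAs (AddCommGroup (Fin s → ℝ))

noncomputable instance (s : ℕ) : Module ℝ (AbelianLie s) :=
  inferInstanceAs (Module ℝ (Fin s → ℝ))

noncomputable instance (s : ℕ) : LieRing (AbelianLie s) where
  bracket _ _ := 0
  add_lie _ _ _ := by simp
  lie_add _ _ _ := by simp
  lie_self _ := rfl
  leibniz_lie _ _ _ := by simp

noncomputable instance (s : ℕ) : LieAlgebra ℝ (AbelianLie s) where
  lie_smul t _ _ := (smul_zero t).symm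

/-- The trivial extension `ℝ^s ⊕ L`: the product Lie algebra, with componentwise bracket. -/
abbrev TrivialExtension (s : ℕ) (L : Type*) : Type _ := AbelianLie s × L

/-! Write `r` for the rank, `N` for the number of positive roots and `𝔫` for the sum of the positive
root spaces. Then `𝔫` is the nilradical of `𝔭`, and `dim 𝔤 = r + 2N`. Given even dimension, `ℝ^s ⊕
𝔫` is symplectic exactly for the root systems `A₁`, `A₂`, `B₂`, that is, for `dim 𝔤` equal to 3, 8
or 10.

Necessity. Let `θ` be the highest root. If it is indecomposable, then `r = N = 1`. Otherwise `e_θ`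
is a central commutator, so closedness makes it `ω`-orthogonal to `ℝ^s` and to the vectors of all
decomposable roots; non-degeneracy then provides an indecomposable `α` with `ω(e_θ, e_α) ≠ 0`.
Summing the cocycle identity over Killing-dual root vectors gives `(∑ (β, θ)) ω(e_θ, e_α) = 0`,
where `β` runs over the positive roots other than `θ`, `α`, `θ - α`
(`sum_apply_rootVec_mul_eq_zero`). No term is negative because `θ` is highest, so all these `β` are
orthogonal to `θ`. By irreducibility only `θ`, `α`, `θ - α` and possibly `θ - 2α` remain
(`finrank_eq_two_and_card`).

Sufficiency. The dimension forces `N` to be 1, 3 or 4. Then `𝔫` has so few brackets that a standard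
two-form in a suitably paired basis is closed (`admitsSymplectic_of_basis`).

Finally, dimension 3, 8 or 10 singles out `sl(2)`, `sl(3)`, `so(5)` among the classical simple
algebras, thanks to the isomorphisms of `so(3)`, `sp(2)`, `sp(4)` with members of this list
(`IsClassicalSimple.finrank_iff`). -/

section SplitSimple

open LieAlgebra LieModule LieAlgebra.IsKilling Module

/-! ### Root strings and the inner product on roots -/

section Roots

variable {L : Type*} [LieRing L] [LieAlgebra ℝ L] [FiniteDimensional ℝ L] [IsKilling ℝ L]
  {H : LieSubalgebra ℝ L} [H.IsCartanSubalgebra] [IsTriangularizable ℝ H L]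

theorem smul_eq_of_mem_rootSpace {α : Weight ℝ H L} (hα : α.IsNonZero) {x y : L}
    (hx : x ∈ rootSpace H α) (hx0 : x ≠ 0) (hy : y ∈ rootSpace H α) : ∃ c : ℝ, c • x = y := by
  obtain ⟨k, hk⟩ := (finrank_eq_one_iff_of_nonzero' (⟨x, hx⟩ : rootSpace H α)
    (by simpa using hx0)).mp (finrank_rootSpace_eq_one _ hα) ⟨y, hy⟩
  exact ⟨k, by simpa using congrArg Subtype.val hk⟩

/-- The bracket of two nonzero root vectors is nonzero as soon as the sum of the roots is a
weight. -/
theorem lie_ne_zero_of_rootSpace_add_ne_bot {α β : Weight ℝ H L} (hα : α.IsNonZero)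
    (hβ : β.IsNonZero) (hαβ : rootSpace H (α + β : H → ℝ) ≠ ⊥) {x y : L}
    (hx : x ∈ rootSpace H α) (hx0 : x ≠ 0) (hy : y ∈ rootSpace H β) (hy0 : y ≠ 0) :
    ⁅x, y⁆ ≠ 0 := by
  -- `sl(2)`-theory on the `α`-string: `y` is a multiple of `f ^ (k + 1) v` with `v` at the top of
  -- the string, and `e` sends this to `(k + 1)(chainLength - k)` times `f ^ k v`, with a nonzero
  -- factor.
  obtain ⟨h, e, f, isSl2, he, hf⟩ := exists_isSl2Triple_of_weight_isNonZero hα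
  obtain ⟨v, hv, hv0⟩ := (chainTop α β).exists_ne_zero
  have hh := isSl2.h_eq_coroot hα he hf
  subst hh
  have prim : isSl2.HasPrimitiveVectorWith v (chainLength α β : ℝ) :=
    have := lie_mem_genWeightSpace_of_mem_genWeightSpace he hv
    ⟨hv0, (chainLength_smul _ _ hv).symm, by rwa [genWeightSpace_add_chainTop _ _ hα] at this⟩
  have htop : 1 ≤ chainTopCoeff α β := by
    have := (rootSpace_zsmul_add_ne_bot_iff α β hα 1).mp (by simpa using hαβ)
    exact_mod_cast this.1
  obtain ⟨k, hk⟩ : ∃ k, chainTopCoeff α β = k + 1 := ⟨_, (Nat.sub_add_cancel htop).symm⟩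
  have hle : k + 1 ≤ chainLength α β := hk ▸ chainTopCoeff_le_chainLength α β
  have hw : (toEnd ℝ L L f ^ (k + 1)) v ∈ rootSpace H β := by
    have := toEnd_pow_apply_mem hf hv (k + 1)
    have h2 : ((k + 1) • (-α : H → ℝ) + chainTop α β : H → ℝ) = β := by
      rw [coe_chainTop, hk, ← Nat.cast_smul_eq_nsmul ℝ, ← Int.cast_smul_eq_zsmul ℝ]
      ext z; simp
    rwa [h2] at this
  have hw0 : (toEnd ℝ L L f ^ (k + 1)) v ≠ 0 := prim.pow_toEnd_f_ne_zero_of_eq_nat rfl hle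
  obtain ⟨c, hc⟩ := smul_eq_of_mem_rootSpace hβ hw hw0 hy
  obtain ⟨d, hd⟩ := smul_eq_of_mem_rootSpace hα he isSl2.e_ne_zero hx
  have hc0 : c ≠ 0 := by rintro rfl; exact hy0 (by simp [← hc])
  have hd0 : d ≠ 0 := by rintro rfl; exact hx0 (by simp [← hd])
  rw [← hc, ← hd, smul_lie, lie_smul, prim.lie_e_pow_succ_toEnd_f k]
  refine smul_ne_zero hd0 (smul_ne_zero hc0 (smul_ne_zero (mul_ne_zero (by positivity) ?_)
    (prim.pow_toEnd_f_ne_zero_of_eq_nat rfl (by omega))))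
  have : (k : ℝ) + 1 ≤ chainLength α β := by exact_mod_cast hle
  linarith

/-- The pairing is the number of steps down minus the number of steps up in the `α`-string through
`β`; here no step up is possible. -/
theorem apply_coroot_nonneg_of_add_eq_bot {α β : Weight ℝ H L} (hα : α.IsNonZero)
    (h : rootSpace H (α + β : H → ℝ) = ⊥) : 0 ≤ β (coroot α) := by
  rw [apply_coroot_eq_cast]
  have := (rootSpace_zsmul_add_ne_bot_iff α β hα 1).not.mp (by simpa using h)
  have h2 : (0 : ℤ) ≤ chainBotCoeff α β - chainTopCoeff α β := by omega
  exact_mod_cast h2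

theorem apply_coroot_pos_of_add_eq_bot_of_sub_ne_bot {α β : Weight ℝ H L} (hα : α.IsNonZero)
    (h : rootSpace H (α + β : H → ℝ) = ⊥) (h' : rootSpace H (β - α : H → ℝ) ≠ ⊥) :
    0 < β (coroot α) := by
  rw [apply_coroot_eq_cast]
  have h1 := (rootSpace_zsmul_add_ne_bot_iff α β hα 1).not.mp (by simpa using h)
  have h2 := (rootSpace_zsmul_add_ne_bot_iff α β hα (-1)).mp
    (by rwa [neg_one_smul, neg_add_eq_sub])
  have h3 : (0 : ℤ) < chainBotCoeff α β - chainTopCoeff α β := by omega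
  exact_mod_cast h3

theorem rootSpace_sub_ne_bot_of_apply_coroot_pos {α β : Weight ℝ H L} (hα : α.IsNonZero)
    (h : 0 < β (coroot α)) : rootSpace H (β - α : H → ℝ) ≠ ⊥ := by
  rw [apply_coroot_eq_cast] at h
  have h' : (0 : ℤ) < chainBotCoeff α β - chainTopCoeff α β := by exact_mod_cast h
  have := (rootSpace_zsmul_add_ne_bot_iff α β hα (-1)).mpr (by omega)
  rwa [neg_one_smul, neg_add_eq_sub] at this

/-- The vector of the Cartan subalgebra representing a root through the Killing form. -/
noncomputable def rootVec (α : Weight ℝ H L) : H :=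
  (cartanEquivDual H).symm (α.toLinear)

theorem traceForm_rootVec (α : Weight ℝ H L) (h : H) :
    traceForm ℝ H L (rootVec α) h = α h :=
  LinearMap.BilinForm.apply_toDual_symm_apply
    (hB := traceForm_cartan_nondegenerate ℝ L H) _ _

theorem apply_rootVec_comm (α β : Weight ℝ H L) : α (rootVec β) = β (rootVec α) := by
  rw [← traceForm_rootVec, traceForm_comm, traceForm_rootVec]

/-- On the Cartan subalgebra the Killing form is `∑ β ⊗ β`. Since the roots are real-valued, this is
a sum of squares, so `α (rootVec β)` behaves as a Euclidean inner product of roots. -/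
theorem apply_rootVec_self_pos {α : Weight ℝ H L} (hα : α.IsNonZero) : 0 < α (rootVec α) := by
  refine lt_of_le_of_ne ?_ (root_apply_cartanEquivDual_symm_ne_zero hα).symm
  have h := congrArg (fun B => B (rootVec α) (rootVec α))
    (restrict_killingForm_eq_sum (H := H) (K := ℝ) (L := L))
  have h2 : ((killingForm ℝ L).restrict H) (rootVec α) (rootVec α) = α (rootVec α) := by
    rw [restrict_killingForm, traceForm_rootVec]
  simp only [h2, LinearMap.sum_apply] at h
  rw [h]
  refine Finset.sum_nonneg fun β _ => ?_
  simp [mul_self_nonneg]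

theorem apply_coroot_eq (α β : Weight ℝ H L) :
    β (coroot α) = 2 * (α (rootVec α))⁻¹ * β (rootVec α) := by
  have : coroot α = (2 * (α (rootVec α))⁻¹) • rootVec α := by
    rw [mul_smul, two_smul, ← two_nsmul]; rfl
  rw [this, ← Weight.toLinear_apply, map_smul, smul_eq_mul, Weight.toLinear_apply]

theorem apply_coroot_pos_iff {α β : Weight ℝ H L} (hα : α.IsNonZero) :
    0 < β (coroot α) ↔ 0 < β (rootVec α) := by
  have := apply_rootVec_self_pos hα
  rw [apply_coroot_eq]
  exact mul_pos_iff_of_pos_left (by positivity)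

theorem apply_coroot_nonneg_iff {α β : Weight ℝ H L} (hα : α.IsNonZero) :
    0 ≤ β (coroot α) ↔ 0 ≤ β (rootVec α) := by
  have := apply_rootVec_self_pos hα
  rw [apply_coroot_eq]
  exact mul_nonneg_iff_of_pos_left (by positivity)

/-- In a simple Lie algebra, a nonempty set of roots which is orthogonal to every root outside it
(up to sign) contains all roots up to sign, and spans the dual of the Cartan subalgebra. -/
theorem forall_mem_or_neg_mem_of_orthogonal [IsSimple ℝ L] (D : Set (Weight ℝ H L))
    (hD : D.Nonempty) (hD0 : ∀ δ ∈ D, δ.IsNonZero)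
    (h : ∀ γ : Weight ℝ H L, γ.IsNonZero → γ ∈ D ∨ -γ ∈ D ∨ ∀ δ ∈ D, δ (rootVec γ) = 0) :
    Submodule.span ℝ (Weight.toLinear ℝ H L '' D) = ⊤ ∧
      ∀ γ : Weight ℝ H L, γ.IsNonZero → γ ∈ D ∨ -γ ∈ D := by
  have hspan : Submodule.span ℝ (Weight.toLinear ℝ H L '' D) = ⊤ := by
    -- The span of `D` is stable under every reflection: a root in `±D` moves vectors along the
    -- span, and a root orthogonal to `D` fixes the span pointwise.
    refine RootPairing.IsIrreducible.eq_top_of_invtSubmodule_reflection (P := rootSystem H) _ ?_ ?_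
    · rintro ⟨γ, hγ⟩
      have hγ : γ.IsNonZero := by simpa using hγ
      rw [Module.End.mem_invtSubmodule, Submodule.span_le]
      rintro _ ⟨δ, hδ, rfl⟩
      simp only [Submodule.comap_coe, LinearEquiv.coe_coe, Set.mem_preimage, SetLike.mem_coe,
        RootPairing.reflection_apply]
      refine sub_mem (Submodule.subset_span ⟨δ, hδ, rfl⟩) ?_
      rcases h γ hγ with h | h | h
      · exact Submodule.smul_mem _ _ (Submodule.subset_span ⟨γ, h, rfl⟩)
      · refine Submodule.smul_mem _ _ ?_
        have : (rootSystem H).root ⟨γ, by simpa using hγ⟩ = - (-γ).toLinear := by simp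
        rw [this]
        exact neg_mem (Submodule.subset_span ⟨-γ, h, rfl⟩)
      · have h0 : δ (coroot γ) = 0 := by rw [apply_coroot_eq, h δ hδ, mul_zero]
        convert Submodule.zero_mem _
        simp [RootPairing.coroot', h0]
    · obtain ⟨δ, hδ⟩ := hD
      intro hbot
      have : δ.toLinear ∈ (⊥ : Submodule ℝ (Dual ℝ H)) := hbot ▸ Submodule.subset_span ⟨δ, hδ, rfl⟩
      exact hD0 δ hδ (by simpa using this)
  refine ⟨hspan, fun γ hγ => ?_⟩
  rcases h γ hγ with h | h | h
  · exact .inl h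
  · exact .inr h
  -- A root orthogonal to a spanning set would be orthogonal to itself.
  · exfalso
    have : γ.toLinear ∈ Submodule.span ℝ (Weight.toLinear ℝ H L '' D) := hspan ▸ Submodule.mem_top
    have h0 : ∀ l ∈ Submodule.span ℝ (Weight.toLinear ℝ H L '' D), l (rootVec γ) = 0 := by
      intro l hl
      induction hl using Submodule.span_induction with
      | mem x hx => obtain ⟨δ, hδ, rfl⟩ := hx; simpa using h δ hδ
      | zero => simp
      | add x y _ _ hx hy => simp [hx, hy]
      | smul a x _ hx => simp [hx]
    exact (apply_rootVec_self_pos hγ).ne' (by simpa using h0 _ this)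

end Roots

/-! ### The homotopy formula for two-cocycles -/

section Homotopy

variable {L : Type*} [LieRing L] [LieAlgebra ℝ L] [FiniteDimensional ℝ L] [IsKilling ℝ L]
  {H : LieSubalgebra ℝ L} [H.IsCartanSubalgebra] [IsTriangularizable ℝ H L]

open Classical in
/-- The roots which are positive at `x`. -/
noncomputable def posRoots (x : H) : Finset (Weight ℝ H L) :=
  Finset.univ.filter fun α => 0 < α x

omit [IsKilling ℝ L] [IsTriangularizable ℝ H L] in
@[simp] theorem mem_posRoots {x : H} {α : Weight ℝ H L} : α ∈ posRoots x ↔ 0 < α x := by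
  simp [posRoots]

omit [FiniteDimensional ℝ L] [IsKilling ℝ L] [IsTriangularizable ℝ H L] in
theorem isNonZero_of_apply_pos {x : H} {α : Weight ℝ H L} (h : 0 < α x) : α.IsNonZero := by
  intro h0
  rw [h0.eq] at h
  simp at h

theorem exists_killingForm_eq_one (α : Weight ℝ H L) : ∃ e f : L, e ∈ rootSpace H α ∧
    f ∈ rootSpace H (-α) ∧ (α.IsNonZero → killingForm ℝ L e f = 1) := by
  by_cases hα : α.IsNonZero
  · obtain ⟨h, e, f, isSl2, he, hf⟩ := exists_isSl2Triple_of_weight_isNonZero hα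
    have h0 : killingForm ℝ L e f ≠ 0 := by
      intro h0
      have := lie_eq_killingForm_smul_of_mem_rootSpace_of_mem_rootSpace_neg he hf
      rw [h0, zero_smul, isSl2.lie_e_f] at this
      exact isSl2.h_ne_zero this
    exact ⟨(killingForm ℝ L e f)⁻¹ • e, f, Submodule.smul_mem _ _ he, hf, fun _ => by simp [h0]⟩
  -- Dummy values at the zero weight, so that `e` and `f` can be chosen as functions on all weights.
  · exact ⟨0, 0, zero_mem _, zero_mem _, fun h => (hα h).elim⟩

/-- Expansion of a root vector in terms of Killing-dual families of root vectors. -/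
theorem sum_killingForm_smul_eq {ι : Type*} (s : Finset ι) (χ : ι → Weight ℝ H L)
    (hχ : Function.Injective χ) (h0 : ∀ i, i ∈ s → (χ i).IsNonZero) (a b : ι → L)
    (hb : ∀ i, b i ∈ rootSpace H (χ i)) (ha : ∀ i, a i ∈ rootSpace H (-(χ i)))
    (hab : ∀ i, i ∈ s → killingForm ℝ L (a i) (b i) = 1) {i : ι} (hi : i ∈ s) {u : L}
    (hu : u ∈ rootSpace H (χ i)) :
    ∑ j ∈ s, killingForm ℝ L (a j) u • b j = u := by
  have hbi : b i ≠ 0 := by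
    intro h
    have := hab i hi
    simp [h] at this
  obtain ⟨c, rfl⟩ := smul_eq_of_mem_rootSpace (h0 i hi) (hb i) hbi hu
  rw [Finset.sum_eq_single i]
  · simp [hab i hi]
  · intro j hj hji
    rw [map_smul, killingForm_apply_eq_zero_of_mem_rootSpace_of_add_ne_zero ℝ L H (ha j) (hb i)]
    · simp
    · intro h
      apply hji
      apply hχ
      apply DFunLike.coe_injective
      rw [neg_add_eq_zero] at h
      exact h
  · exact fun h => (h hi).elim

omit [IsKilling ℝ L] in
theorem sum_killingForm_smul_eq_zero {ι : Type*} (s : Finset ι) (χ : ι → Weight ℝ H L)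
    (a b : ι → L) (ha : ∀ i, a i ∈ rootSpace H (-(χ i))) {φ : H → ℝ} (hφ : ∀ i ∈ s, φ ≠ χ i)
    {u : L} (hu : u ∈ rootSpace H φ) :
    ∑ j ∈ s, killingForm ℝ L (a j) u • b j = 0 := by
  refine Finset.sum_eq_zero fun j hj => ?_
  rw [killingForm_apply_eq_zero_of_mem_rootSpace_of_add_ne_zero ℝ L H (ha j) hu, zero_smul]
  intro h
  rw [neg_add_eq_zero] at h
  exact hφ j hj h.symm

omit [IsKilling ℝ L] [FiniteDimensional ℝ L] [IsTriangularizable ℝ H L] in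
theorem eq_zero_of_mem_rootSpace_of_lt {x : H} {θ : Weight ℝ H L}
    (hmax : ∀ β : Weight ℝ H L, β x ≤ θ x) {φ : H → ℝ} (hφ : θ x < φ x) {u : L}
    (hu : u ∈ rootSpace H φ) : u = 0 := by
  by_contra hu0
  have hb : rootSpace H φ ≠ ⊥ := fun h => hu0 (by simpa [h] using hu)
  exact absurd (hmax ⟨φ, hb⟩) (not_le.mpr hφ)

omit [IsKilling ℝ L] [FiniteDimensional ℝ L] [IsTriangularizable ℝ H L] in
-- Regularity of `x` upgrades `0 ≤ φ x` to strict positivity whenever `φ` is a root; if it is not,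
-- the vector vanishes.
theorem mem_of_mem_rootSpace_of_nonneg {x : H}
    (hx : ∀ α : Weight ℝ H L, α.IsNonZero → α x ≠ 0) {N : Submodule ℝ L}
    (hN : ∀ β : Weight ℝ H L, 0 < β x → (rootSpace H β).toSubmodule ≤ N) {φ : H → ℝ}
    (hφ : φ ≠ 0) (hφx : 0 ≤ φ x) {u : L} (hu : u ∈ rootSpace H φ) : u ∈ N := by
  by_cases hu0 : u = 0
  · simp [hu0]
  have hb : rootSpace H φ ≠ ⊥ := fun h => hu0 (by simpa [h] using hu)
  exact hN ⟨φ, hb⟩ (lt_of_le_of_ne hφx (hx ⟨φ, hb⟩ hφ).symm) hu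

theorem rootSpace_eq_bot_of_eq_two_smul {α : Weight ℝ H L} (hα : α.IsNonZero) {φ : H → ℝ}
    (hφ : φ = α + α) : rootSpace H φ = ⊥ := by
  rw [hφ, ← two_smul ℕ]; exact rootSpace_two_smul α hα

open Classical in
/-- A two-cocycle `ω` on the sum of the positive root spaces, evaluated at the highest root vector
and at an indecomposable one, is annihilated by a sum of inner products of roots. This is the
homotopy formula for the Kostant Laplacian. -/
theorem sum_apply_rootVec_mul_eq_zero {x : H} (hx : ∀ α : Weight ℝ H L, α.IsNonZero → α x ≠ 0)
    {θ α : Weight ℝ H L} (hmax : ∀ β : Weight ℝ H L, β x ≤ θ x)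
    (hα : 0 < α x) (hind : ∀ β γ : Weight ℝ H L, 0 < β x → 0 < γ x → (β + γ : H → ℝ) ≠ α)
    {N : Submodule ℝ L}
    (hN : ∀ β : Weight ℝ H L, 0 < β x → (rootSpace H β).toSubmodule ≤ N)
    (ω : LinearMap.BilinForm ℝ L) (alt : ω.IsAlt)
    (closed : ∀ u ∈ N, ∀ v ∈ N, ∀ w ∈ N, ω ⁅u, v⁆ w - ω ⁅u, w⁆ v + ω ⁅v, w⁆ u = 0)
    {eθ eα : L} (heθ : eθ ∈ rootSpace H θ) (heα : eα ∈ rootSpace H α) :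
    (∑ β ∈ (posRoots x).filter fun β => β ≠ θ ∧ β ≠ α ∧ (β : H → ℝ) ≠ θ - α,
      β (rootVec θ)) * ω eθ eα = 0 := by
  set Q := (posRoots x).filter fun β : Weight ℝ H L => β ≠ θ ∧ β ≠ α ∧ (β : H → ℝ) ≠ θ - α
  have hQ : ∀ β : Weight ℝ H L, β ∈ Q ↔ 0 < β x ∧ β ≠ θ ∧ β ≠ α ∧ (β : H → ℝ) ≠ θ - α := by
    simp [Q]
  have hnz : ∀ β ∈ Q, β.IsNonZero := fun β hβ => isNonZero_of_apply_pos ((hQ β).mp hβ).1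
  have hα0 := isNonZero_of_apply_pos hα
  choose e f he hf hef using exists_killingForm_eq_one (H := H) (L := L)
  have hNα : eα ∈ N := hN α hα heα
  have hfθ : ∀ β : Weight ℝ H L, ⁅f β, eθ⁆ ∈ rootSpace H (-β + θ : H → ℝ) := fun β =>
    lie_mem_genWeightSpace_of_mem_genWeightSpace (hf β) heθ
  have heα' : ∀ β : Weight ℝ H L, ⁅e β, eα⁆ ∈ rootSpace H (β + α : H → ℝ) := fun β =>
    lie_mem_genWeightSpace_of_mem_genWeightSpace (he β) heα
  have hfα' : ∀ β : Weight ℝ H L, ⁅f β, eα⁆ ∈ rootSpace H (-β + α : H → ℝ) := fun β =>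
    lie_mem_genWeightSpace_of_mem_genWeightSpace (hf β) heα
  have hθα : ⁅eθ, eα⁆ = 0 := eq_zero_of_mem_rootSpace_of_lt (φ := θ + α) hmax (by simpa using hα)
    (lie_mem_genWeightSpace_of_mem_genWeightSpace heθ heα)
  -- Expand `⁅e β, eα⁆` in the vectors `e γ`. The delicate point is a root `β + α` outside `Q`: it
  -- cannot be `θ` or `α`, so it is `θ - α`.
  have hC : ∀ β ∈ Q, ω ⁅e β, eα⁆ ⁅f β, eθ⁆ =
      ∑ γ ∈ Q, killingForm ℝ L (f γ) ⁅e β, eα⁆ * ω (e γ) ⁅f β, eθ⁆ := by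
    intro β hβ
    obtain ⟨hβx, hβθ, hβα, hβθα⟩ := (hQ β).mp hβ
    have hsum : ∑ γ ∈ Q, killingForm ℝ L (f γ) ⁅e β, eα⁆ * ω (e γ) ⁅f β, eθ⁆ =
        ω (∑ γ ∈ Q, killingForm ℝ L (f γ) ⁅e β, eα⁆ • e γ) ⁅f β, eθ⁆ := by
      simp [LinearMap.sum_apply]
    rw [hsum]
    by_cases hb : ∃ γ ∈ Q, (β + α : H → ℝ) = γ
    · obtain ⟨γ, hγ, h⟩ := hb
      rw [sum_killingForm_smul_eq Q id Function.injective_id hnz f e he hf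
        (fun i hi => by rw [traceForm_comm]; exact hef i (hnz i hi)) hγ (h ▸ heα' β)]
    · push Not at hb
      rw [sum_killingForm_smul_eq_zero Q id f e hf hb (heα' β)]
      by_cases h0 : rootSpace H (β + α : H → ℝ) = ⊥
      · have : ⁅e β, eα⁆ = 0 := by simpa [h0] using heα' β
        simp [this]
      have hn := mt (hQ ⟨_, h0⟩).mpr (fun h => hb _ h rfl)
      have h1 : (0:ℝ) < (⟨_, h0⟩ : Weight ℝ H L) x := add_pos hβx hα
      have h2 : (⟨_, h0⟩ : Weight ℝ H L) ≠ θ := by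
        intro h
        apply hβθα
        rw [← h]; ext; simp
      have h3 : (⟨_, h0⟩ : Weight ℝ H L) ≠ α := by
        intro h
        have := congrArg (fun w : Weight ℝ H L => w x) h
        simp at this
        linarith
      have h4 : (β + α : H → ℝ) = θ - α := by
        by_contra h4
        exact hn ⟨h1, h2, h3, h4⟩
      -- Here `θ - β = 2α`, which is not a root, so the other argument of `ω` vanishes.
      have : ⁅f β, eθ⁆ = 0 := by
        have := hfθ β
        rwa [rootSpace_eq_bot_of_eq_two_smul hα0
          (by
            ext z
            have := congrFun h4 z
            simp only [Pi.add_apply, Pi.sub_apply, Pi.neg_apply] at this ⊢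
            linarith),
          LieSubmodule.mem_bot] at this
      simp [this]
  -- Dually, expand `⁅f γ, eα⁆` in the vectors `f β`.
  have hD : ∀ γ ∈ Q, ω ⁅⁅f γ, eα⁆, eθ⁆ (e γ) =
      ∑ β ∈ Q, killingForm ℝ L (e β) ⁅f γ, eα⁆ * ω ⁅f β, eθ⁆ (e γ) := by
    intro γ hγ
    obtain ⟨hγx, hγθ, hγα, hγθα⟩ := (hQ γ).mp hγ
    have hsum : ∑ β ∈ Q, killingForm ℝ L (e β) ⁅f γ, eα⁆ * ω ⁅f β, eθ⁆ (e γ) =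
        ω ⁅∑ β ∈ Q, killingForm ℝ L (e β) ⁅f γ, eα⁆ • f β, eθ⁆ (e γ) := by
      simp [LinearMap.sum_apply, sum_lie]
    rw [hsum]
    have he' : ∀ β : Weight ℝ H L, e β ∈ rootSpace H (-(⇑(-β)) : H → ℝ) := by
      intro β; simpa using he β
    have hf' : ∀ β : Weight ℝ H L, f β ∈ rootSpace H (⇑(-β) : H → ℝ) := by
      intro β; simpa using hf β
    by_cases hb : ∃ β ∈ Q, (-γ + α : H → ℝ) = ⇑(-β)
    · obtain ⟨β, hβ, h⟩ := hb
      rw [sum_killingForm_smul_eq Q (fun β => -β) neg_injective (fun i hi => (hnz i hi).neg) e f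
        hf' he' (fun i hi => hef i (hnz i hi)) hβ (h ▸ hfα' γ)]
    · push Not at hb
      rw [sum_killingForm_smul_eq_zero Q (fun β => -β) e f he' hb (hfα' γ)]
      suffices rootSpace H (-γ + α : H → ℝ) = ⊥ by
        have h0 : ⁅f γ, eα⁆ = 0 := by simpa [this] using hfα' γ
        simp [h0]
      by_contra h0
      let W : Weight ℝ H L := ⟨_, h0⟩
      have hW : (W : H → ℝ) = -γ + α := rfl
      have hnW : ((-W : Weight ℝ H L) : H → ℝ) = γ - α := by
        rw [Weight.coe_neg, hW]; abel
      have hW0 : W.IsNonZero := by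
        intro h
        apply hγα
        apply DFunLike.coe_injective
        exact neg_add_eq_zero.mp (hW ▸ h)
      -- Were `α - γ` positive, `α = γ + (α - γ)` would decompose `α`. So `γ - α` is a positive
      -- root, and the remaining ways to fall outside `Q` are ruled out in turn.
      have hWx : W x < 0 := by
        refine lt_of_le_of_ne (not_lt.mp fun h => ?_) (hx W hW0)
        exact hind γ W hγx h (by rw [hW]; abel)
      have hn := mt (hQ (-W)).mpr (fun h => hb _ h (by rw [neg_neg, hW]))
      have h1 : 0 < (-W) x := by simpa using hWx
      have h2 : -W ≠ θ := by
        intro h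
        have h5 := congrFun hnW x
        rw [h] at h5
        have := hmax γ
        simp at h5
        linarith
      have h3 : -W ≠ α := by
        intro h
        rw [h] at hnW
        refine γ.genWeightSpace_ne_bot L (rootSpace_eq_bot_of_eq_two_smul hα0 ?_)
        rw [eq_sub_iff_add_eq] at hnW
        exact hnW.symm
      have h4 : ((-W : Weight ℝ H L) : H → ℝ) = θ - α := by
        by_contra h4
        exact hn ⟨h1, h2, h3, h4⟩
      rw [hnW, sub_left_inj] at h4
      exact hγθ (DFunLike.coe_injective h4)
  have hcoc : ∀ β ∈ Q, β (rootVec θ) * ω eθ eα =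
      ω ⁅e β, eα⁆ ⁅f β, eθ⁆ - ω ⁅⁅f β, eα⁆, eθ⁆ (e β) := by
    intro β hβ
    obtain ⟨hβx, hβθ, hβα, hβθα⟩ := (hQ β).mp hβ
    -- The cocycle identity on `e β`, `⁅f β, eθ⁆`, `eα`. The root `θ` is kept out of `Q` because `⁅f
    -- θ, eθ⁆` lies in the Cartan subalgebra, where closedness is not assumed.
    have hc := closed (e β) (hN β hβx (he β)) ⁅f β, eθ⁆
      (mem_of_mem_rootSpace_of_nonneg hx hN
        (fun h => hβθ (DFunLike.coe_injective (neg_add_eq_zero.mp h)))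
        (by have := hmax β; simp; linarith) (hfθ β)) eα hNα
    have hβθ0 : ⁅e β, eθ⁆ = 0 :=
      eq_zero_of_mem_rootSpace_of_lt (φ := β + θ) hmax (by simpa using hβx)
      (lie_mem_genWeightSpace_of_mem_genWeightSpace (he β) heθ)
    have h1 : ⁅e β, ⁅f β, eθ⁆⁆ = β (rootVec θ) • eθ := by
      rw [leibniz_lie, hβθ0, lie_zero, add_zero,
        lie_eq_killingForm_smul_of_mem_rootSpace_of_mem_rootSpace_neg (he β) (hf β),
        hef β (hnz β hβ), one_smul, apply_rootVec_comm]
      exact lie_eq_smul_of_mem_rootSpace heθ (rootVec β)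
    have h2 : ⁅⁅f β, eθ⁆, eα⁆ = ⁅⁅f β, eα⁆, eθ⁆ := by
      rw [lie_lie, hθα, lie_zero, zero_sub, lie_skew]
    rw [h1, h2] at hc
    simp only [map_smul, LinearMap.smul_apply, smul_eq_mul] at hc
    linarith
  rw [Finset.sum_mul, Finset.sum_congr rfl hcoc, Finset.sum_sub_distrib, Finset.sum_congr rfl hC,
    Finset.sum_congr rfl hD, Finset.sum_comm, sub_eq_zero]
  refine Finset.sum_congr rfl fun γ hγ => Finset.sum_congr rfl fun β hβ => ?_
  -- Invariance of the Killing form and skew-symmetry of `ω` each contribute a sign, so the two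
  -- double sums agree term by term.
  have h1 : killingForm ℝ L (e β) ⁅f γ, eα⁆ = -killingForm ℝ L (f γ) ⁅e β, eα⁆ := by
    rw [← lie_skew, map_neg, ← traceForm_apply_lie_apply, traceForm_comm]
  have h2 : ω ⁅f β, eθ⁆ (e γ) = - ω (e γ) ⁅f β, eθ⁆ := by
    have := alt.neg_eq (f β |> fun u => ⁅u, eθ⁆) (e γ)
    linarith
  rw [h1, h2]
  ring

end Homotopy

/-! ### Grading by the value at a regular element -/

section RootSum

variable {L : Type*} [LieRing L] [LieAlgebra ℝ L]
  {H : LieSubalgebra ℝ L} [H.IsCartanSubalgebra]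

/-- The sum of the generalized weight spaces of the weights whose value at `x` lies in `T`. -/
noncomputable def rootSum (x : H) (T : Set ℝ) : Submodule ℝ L :=
  ⨆ (α : Weight ℝ H L) (_ : α x ∈ T), (rootSpace H α).toSubmodule

theorem mem_rootSum {x : H} {T : Set ℝ} {φ : H → ℝ} (hφ : φ x ∈ T) {u : L}
    (hu : u ∈ rootSpace H φ) : u ∈ rootSum x T := by
  by_cases hb : rootSpace H φ = ⊥
  · have : u = 0 := by simpa [hb] using hu
    simp [this]
  · exact Submodule.mem_iSup_of_mem (⟨φ, hb⟩ : Weight ℝ H L) (Submodule.mem_iSup_of_mem hφ hu)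

theorem rootSum_induction {x : H} {T : Set ℝ} {p : L → Prop}
    (mem : ∀ α : Weight ℝ H L, α x ∈ T → ∀ u ∈ rootSpace H α, p u) (zero : p 0)
    (add : ∀ u v, p u → p v → p (u + v)) {u : L} (hu : u ∈ rootSum x T) : p u := by
  refine Submodule.iSup_induction _ (motive := p) hu (fun α v hv => ?_) zero add
  exact Submodule.iSup_induction _ (motive := p) hv (fun h w hw => mem α h w hw) zero add

/-- Weights add under the bracket, hence so do their values at `x`. Different choices of `A`, `B`,
`C` give subalgebras, ideals and the filtration behind nilpotency. -/
theorem lie_mem_rootSum {x : H} {A B C : Set ℝ} (hABC : ∀ a ∈ A, ∀ b ∈ B, a + b ∈ C) {u v : L}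
    (hu : u ∈ rootSum x A) (hv : v ∈ rootSum x B) : ⁅u, v⁆ ∈ rootSum x C := by
  refine rootSum_induction (p := fun u => ⁅u, v⁆ ∈ rootSum x C) (fun α hα u hu => ?_) (by simp)
    (fun u₁ u₂ h₁ h₂ => by rw [add_lie]; exact add_mem h₁ h₂) hu
  refine rootSum_induction (p := fun v => ⁅u, v⁆ ∈ rootSum x C) (fun β hβ v hv => ?_) (by simp)
    (fun u₁ u₂ h₁ h₂ => by rw [lie_add]; exact add_mem h₁ h₂) hv
  exact mem_rootSum (φ := (α + β : H → ℝ)) (hABC _ hα _ hβ)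
    (lie_mem_genWeightSpace_of_mem_genWeightSpace hu hv)

/-- The subalgebra spanned by the positive root spaces. -/
noncomputable def posRootSubalgebra (x : H) : LieSubalgebra ℝ L where
  __ := rootSum x (Set.Ioi 0)
  lie_mem' hu hv := lie_mem_rootSum (fun _ ha _ hb => add_pos ha hb) hu hv

end RootSum

/-! ### Root systems in which few positive roots meet the highest one -/

section Combinatorics

variable {L : Type*} [LieRing L] [LieAlgebra ℝ L] [FiniteDimensional ℝ L]
  {H : LieSubalgebra ℝ L} [H.IsCartanSubalgebra] [IsTriangularizable ℝ H L]

open Classical in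
-- Root space decomposition: the zero weight contributes `H`, every root a line, and negation
-- exchanges positive and negative roots.
theorem finrank_eq_finrank_add_two_mul_card [IsKilling ℝ L] [Nontrivial L] {x : H}
    (hx : ∀ α : Weight ℝ H L, α.IsNonZero → α x ≠ 0) :
    finrank ℝ L = finrank ℝ H + 2 * (posRoots x).card := by
  have hint : DirectSum.IsInternal fun α : Weight ℝ H L => (rootSpace H α).toSubmodule :=
    DirectSum.isInternal_submodule_of_iSupIndep_of_iSup_eq_top
      (LieSubmodule.iSupIndep_toSubmodule.mpr <| iSupIndep_genWeightSpace' ℝ H L)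
      (LieSubmodule.iSup_toSubmodule_eq_top.mpr <| iSup_genWeightSpace_eq_top' ℝ H L)
  let E := LinearEquiv.ofBijective
    (DirectSum.coeLinearMap fun α : Weight ℝ H L => (rootSpace H α).toSubmodule) hint
  rw [← E.finrank_eq, finrank_directSum,
    ← Finset.sum_erase_add _ _ (Finset.mem_univ (0 : Weight ℝ H L)), add_comm]
  congr 1
  · have : rootSpace H ((0 : Weight ℝ H L) : H → ℝ) = H.toLieSubmodule := by
      rw [← rootSpace_zero_eq ℝ L H]; rfl
    rw [this]; rfl
  · have hset : Finset.univ.erase (0 : Weight ℝ H L) =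
        posRoots x ∪ (posRoots x).image (fun α => -α) := by
      ext α
      simp only [Finset.mem_erase, Finset.mem_univ, and_true, Finset.mem_union, mem_posRoots,
        Finset.mem_image]
      constructor
      · intro h
        have h0 : α.IsNonZero := fun h' => h (by ext z; simp [h'.eq])
        rcases lt_or_gt_of_ne (hx α h0) with h1 | h1
        · exact .inr ⟨-α, by simpa using h1, neg_neg α⟩
        · exact .inl h1
      · rintro (h | ⟨β, h, rfl⟩) h0
        · simp [h0] at h
        · have : β = -0 := by rw [← h0, neg_neg]
          simp [this] at h
    have hdisj : Disjoint (posRoots x) ((posRoots x).image (fun α => -α)) := by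
      rw [Finset.disjoint_left]
      intro α hα h
      obtain ⟨β, hβ, rfl⟩ := Finset.mem_image.mp h
      simp at hα hβ
      linarith
    rw [hset, Finset.sum_congr rfl (g := fun _ => 1), Finset.sum_const, Finset.card_union_of_disjoint hdisj,
      Finset.card_image_of_injective _ neg_injective]
    · simp; ring
    · intro α hα
      refine finrank_rootSpace_eq_one α ?_
      rw [← hset] at hα
      intro h0
      exact (Finset.mem_erase.mp hα).1 (by ext z; simp [h0.eq])

variable [IsSimple ℝ L]

theorem posRoots_eq_of_orthogonal {x : H} (hx : ∀ α : Weight ℝ H L, α.IsNonZero → α x ≠ 0)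
    (D : Finset (Weight ℝ H L)) (hD : D.Nonempty) (hDpos : ∀ δ ∈ D, 0 < δ x)
    (h : ∀ γ : Weight ℝ H L, 0 < γ x → γ ∉ D → ∀ δ ∈ D, γ (rootVec δ) = 0) :
    Submodule.span ℝ (Weight.toLinear ℝ H L '' D) = ⊤ ∧ posRoots x = D := by
  obtain ⟨h1, h2⟩ := forall_mem_or_neg_mem_of_orthogonal (D : Set (Weight ℝ H L)) hD
    (fun δ hδ => isNonZero_of_apply_pos (hDpos δ hδ)) (fun γ hγ => by
      by_cases hm : γ ∈ D
      · exact .inl hm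
      by_cases hm' : -γ ∈ D
      · exact .inr (.inl hm')
      refine .inr (.inr fun δ hδ => ?_)
      rw [apply_rootVec_comm]
      rcases lt_or_gt_of_ne (hx γ hγ) with hlt | hlt
      · have := h (-γ) (by simpa using hlt) hm' δ hδ
        simpa using this
      · exact h γ hlt hm δ hδ)
  refine ⟨h1, ?_⟩
  ext γ
  rw [mem_posRoots]
  refine ⟨fun hγ => ?_, hDpos γ⟩
  rcases h2 γ (isNonZero_of_apply_pos hγ) with h | h
  · exact h
  · have := hDpos _ h
    simp at this
    linarith

theorem apply_rootVec_nonneg_of_max {x : H} {θ : Weight ℝ H L}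
    (hmax : ∀ β : Weight ℝ H L, β x ≤ θ x) (hθ : 0 < θ x) {β : Weight ℝ H L} (hβ : 0 < β x) :
    0 ≤ β (rootVec θ) := by
  refine (apply_coroot_nonneg_iff (isNonZero_of_apply_pos hθ)).mp
    (apply_coroot_nonneg_of_add_eq_bot (isNonZero_of_apply_pos hθ) ?_)
  by_contra hb
  have := hmax ⟨_, hb⟩
  simp at this
  linarith

/-- If `γ ≠ θ` is positive with `(γ, θ) > 0`, then `θ - γ` is a positive root and `θ` decomposes. So
`θ` is orthogonal to all other positive roots, and irreducibility leaves `θ` alone. -/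
theorem finrank_eq_one_and_card_eq_one {x : H} (hx : ∀ α : Weight ℝ H L, α.IsNonZero → α x ≠ 0)
    {θ : Weight ℝ H L} (hmax : ∀ β : Weight ℝ H L, β x ≤ θ x) (hθ : 0 < θ x)
    (hind : ∀ β γ : Weight ℝ H L, 0 < β x → 0 < γ x → (β + γ : H → ℝ) ≠ θ) :
    finrank ℝ H = 1 ∧ (posRoots x).card = 1 := by
  have hθ0 := isNonZero_of_apply_pos hθ
  obtain ⟨h1, h2⟩ := posRoots_eq_of_orthogonal hx {θ} (by simp) (by simpa using hθ) (by
    intro γ hγ hγθ δ hδ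
    rw [Finset.mem_singleton] at hγθ hδ
    subst hδ
    refine le_antisymm (not_lt.mp fun hpos => ?_) (apply_rootVec_nonneg_of_max hmax hθ hγ)
    rw [apply_rootVec_comm] at hpos
    have hγ0 := isNonZero_of_apply_pos hγ
    have hb := rootSpace_sub_ne_bot_of_apply_coroot_pos hγ0 ((apply_coroot_pos_iff hγ0).mpr hpos)
    refine hind γ ⟨_, hb⟩ hγ (lt_of_le_of_ne ?_ (hx ⟨_, hb⟩ fun h => hγθ ?_).symm) (by simp)
    · simpa using hmax γ
    · exact (DFunLike.coe_injective (sub_eq_zero.mp h)).symm)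
  refine ⟨?_, by simp [h2]⟩
  rw [← Subspace.dual_finrank_eq, ← finrank_top ℝ (Dual ℝ H), ← h1]
  rw [Finset.coe_singleton, Set.image_singleton, finrank_span_singleton]
  simpa using hθ0

theorem finrank_eq_two_of_span {x : H} {θ α : Weight ℝ H L} (hθ : 0 < θ x) (hα : 0 < α x)
    (hne : α ≠ θ) {D : Set (Weight ℝ H L)}
    (hD : Submodule.span ℝ (Weight.toLinear ℝ H L '' D) = ⊤)
    (h : ∀ δ ∈ D, ∃ a b : ℝ, δ.toLinear = a • α.toLinear + b • θ.toLinear) :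
    finrank ℝ H = 2 := by
  have hli : LinearIndependent ℝ ![α.toLinear, θ.toLinear] := by
    rw [LinearIndependent.pair_iff' (by simpa using isNonZero_of_apply_pos hα)]
    intro a ha
    -- Proportional roots agree up to sign, and two distinct positive ones cannot.
    rcases eq_neg_or_eq_of_eq_smul α θ (isNonZero_of_apply_pos hθ) a
      (by ext z; simpa using (LinearMap.congr_fun ha z).symm) with h | h
    · rw [h] at hθ
      simp at hθ
      linarith
    · exact hne h.symm
  have htop : Submodule.span ℝ (Set.range ![α.toLinear, θ.toLinear]) = ⊤ := by
    rw [← top_le_iff, ← hD, Submodule.span_le]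
    rintro _ ⟨δ, hδ, rfl⟩
    obtain ⟨a, b, hab⟩ := h δ hδ
    rw [hab]
    exact add_mem (Submodule.smul_mem _ _ (Submodule.subset_span ⟨0, rfl⟩))
      (Submodule.smul_mem _ _ (Submodule.subset_span ⟨1, rfl⟩))
  rw [← Subspace.dual_finrank_eq, ← finrank_top ℝ (Dual ℝ H), ← htop, finrank_span_eq_card hli]
  simp

open Classical in
-- The vanishing sum has non-negative terms, so only `θ`, `α` and `β = θ - α` can meet `θ`. A
-- further positive root that is not orthogonal to `α` must be `β - α`. These three or four roots
-- are orthogonal to all others, so they exhaust the positive roots: type `A₂` or `B₂`.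
theorem finrank_eq_two_and_card {x : H} (hx : ∀ α : Weight ℝ H L, α.IsNonZero → α x ≠ 0)
    {θ α : Weight ℝ H L} (hmax : ∀ β : Weight ℝ H L, β x ≤ θ x) (hθ : 0 < θ x)
    (hα : 0 < α x) (hind : ∀ β γ : Weight ℝ H L, 0 < β x → 0 < γ x → (β + γ : H → ℝ) ≠ α)
    (hne : α ≠ θ)
    (hsum : ∑ β ∈ (posRoots x).filter fun β => β ≠ θ ∧ β ≠ α ∧ (β : H → ℝ) ≠ θ - α,
      β (rootVec θ) = 0) :
    finrank ℝ H = 2 ∧ ((posRoots x).card = 3 ∨ (posRoots x).card = 4) := by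
  have hθ0 := isNonZero_of_apply_pos hθ
  have hα0 := isNonZero_of_apply_pos hα
  have hQ : ∀ β : Weight ℝ H L, 0 < β x → β ≠ θ → β ≠ α → (β : H → ℝ) ≠ θ - α →
      β (rootVec θ) = 0 := by
    intro β h1 h2 h3 h4
    refine (Finset.sum_eq_zero_iff_of_nonneg fun γ hγ => ?_).mp hsum β (by simp [*])
    simp only [Finset.mem_filter, mem_posRoots] at hγ
    exact apply_rootVec_nonneg_of_max hmax hθ hγ.1
  have hadd : ∀ β : Weight ℝ H L, 0 < β x → rootSpace H (β + θ : H → ℝ) = ⊥ := by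
    intro β hβ
    by_contra hb
    have := hmax ⟨_, hb⟩
    simp at this
    linarith
  by_cases hb : rootSpace H (θ - α : H → ℝ) = ⊥
  -- If `θ - α` is not a root, then `α` too is orthogonal to `θ`, which makes `θ` the only positive
  -- root.
  · exfalso
    have hαθ : α (rootVec θ) = 0 := by
      refine le_antisymm (not_lt.mp fun hpos => ?_) (apply_rootVec_nonneg_of_max hmax hθ hα)
      rw [apply_rootVec_comm] at hpos
      exact rootSpace_sub_ne_bot_of_apply_coroot_pos hα0 ((apply_coroot_pos_iff hα0).mpr hpos) hb
    have := (posRoots_eq_of_orthogonal hx {θ} (by simp) (by simpa using hθ) (by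
      intro γ hγ hγθ δ hδ
      rw [Finset.mem_singleton] at hγθ hδ
      subst hδ
      by_cases h : γ = α
      · rwa [h]
      · exact hQ γ hγ hγθ h fun h' => γ.genWeightSpace_ne_bot L (h' ▸ hb))).2
    have h1 : α ∈ posRoots x := by simpa using hα
    rw [this, Finset.mem_singleton] at h1
    exact hne h1
  · obtain ⟨β, hβ⟩ : ∃ β : Weight ℝ H L, (β : H → ℝ) = θ - α := ⟨⟨_, hb⟩, rfl⟩
    have hβv : ∀ z, β z = θ z - α z := fun z => congrFun hβ z
    have hβ0 : β.IsNonZero := fun h => hne (DFunLike.coe_injective (sub_eq_zero.mp (hβ ▸ h))).symm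
    have hβx : 0 < β x := by
      refine lt_of_le_of_ne ?_ (hx β hβ0).symm
      rw [hβv]
      linarith [hmax α]
    have hαβ : α ≠ β := by
      intro h
      refine θ.genWeightSpace_ne_bot L (rootSpace_eq_bot_of_eq_two_smul hα0 ?_)
      nth_rewrite 2 [h]
      rw [hβ]; abel
    have hβθ : β ≠ θ := by
      intro h
      have := hβv x
      rw [h] at this
      linarith
    have hαpos : 0 < α (rootVec θ) := by
      rw [apply_rootVec_comm, ← apply_coroot_pos_iff hα0]
      exact apply_coroot_pos_of_add_eq_bot_of_sub_ne_bot hα0 (hadd α hα) hb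
    have hβpos : 0 < β (rootVec θ) := by
      rw [apply_rootVec_comm, ← apply_coroot_pos_iff hβ0]
      refine apply_coroot_pos_of_add_eq_bot_of_sub_ne_bot hβ0 (hadd β hβx) ?_
      rw [hβ, sub_sub_cancel]
      exact α.genWeightSpace_ne_bot L
    have hmem : ∀ γ : Weight ℝ H L, 0 < γ x → 0 < γ (rootVec θ) → γ = θ ∨ γ = α ∨ γ = β := by
      intro γ h1 h2
      by_contra! h
      exact h2.ne' (hQ γ h1 h.1 h.2.1 fun h' => h.2.2 (DFunLike.coe_injective (h'.trans hβ.symm)))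
    have hrest : ∀ γ : Weight ℝ H L, 0 < γ x → γ ≠ θ → γ ≠ α → γ ≠ β → γ (rootVec θ) = 0 :=
      fun γ h1 h2 h3 h4 => hQ γ h1 h2 h3 fun h' => h4 (DFunLike.coe_injective (h'.trans hβ.symm))
    have hβvec : ∀ γ : Weight ℝ H L, γ (rootVec β) = γ (rootVec θ) - γ (rootVec α) := by
      intro γ
      rw [apply_rootVec_comm, hβv, apply_rootVec_comm θ, apply_rootVec_comm α]
    have hlin : ∀ δ : Weight ℝ H L, ∀ a b : ℝ, (∀ z, δ z = a * α z + b * θ z) →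
        ∃ a b : ℝ, δ.toLinear = a • α.toLinear + b • θ.toLinear := by
      intro δ a b h
      exact ⟨a, b, by ext z; simpa using h z⟩
    have hnonadj : ∀ γ : Weight ℝ H L, 0 < γ x → γ ≠ θ → γ ≠ α → γ ≠ β → γ (rootVec α) ≠ 0 →
        ∀ z, γ z = β z - α z := by
      intro γ h1 h2 h3 h4 h5
      have hγθ := hrest γ h1 h2 h3 h4
      -- If `(γ, δ) < 0`, then `δ + γ` is a root whose product with `θ` is still positive, so it is
      -- one of the three roots known to meet `θ`. As `(γ, β) = -(γ, α)`, this applies to `α` or to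
      -- `β`.
      have key : ∀ δ : Weight ℝ H L, 0 < δ x → 0 < δ (rootVec θ) → γ (rootVec δ) < 0 →
          ∃ ε : Weight ℝ H L, (ε = θ ∨ ε = α ∨ ε = β) ∧ (ε : H → ℝ) = δ + γ := by
        intro δ hδ hδθ hneg
        have hδ0 := isNonZero_of_apply_pos hδ
        have hbd : rootSpace H (δ + γ : H → ℝ) ≠ ⊥ := fun h =>
          absurd ((apply_coroot_nonneg_iff hδ0).mp (apply_coroot_nonneg_of_add_eq_bot hδ0 h))
            (not_le.mpr hneg)
        exact ⟨⟨_, hbd⟩, hmem ⟨_, hbd⟩ (by simpa using add_pos hδ h1) (by simp [hγθ, hδθ]), rfl⟩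
      rcases lt_or_gt_of_ne h5 with hlt | hlt
      · obtain ⟨ε, hε, hεv⟩ := key α hα hαpos hlt
        have hv : ∀ z, ε z = α z + γ z := fun z => congrFun hεv z
        rcases hε with rfl | rfl | rfl
        · refine (h4 (DFunLike.ext _ _ fun z => ?_)).elim
          rw [hβv, hv]; ring
        · have := hv x
          linarith
        · intro z
          rw [hv]; ring
      · obtain ⟨ε, hε, hεv⟩ := key β hβx hβpos (by rw [hβvec, hγθ]; linarith)
        have hv : ∀ z, ε z = β z + γ z := fun z => congrFun hεv z
        rcases hε with rfl | rfl | rfl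
        · refine (h3 (DFunLike.ext _ _ fun z => ?_)).elim
          have := hβv z
          have := hv z
          linarith
        · exact (hind β γ hβx h1 hεv.symm).elim
        · have := hv x
          linarith
    by_cases hex : ∃ γ : Weight ℝ H L, 0 < γ x ∧ γ ≠ θ ∧ γ ≠ α ∧ γ ≠ β ∧ γ (rootVec α) ≠ 0
    · obtain ⟨γ, h1, h2, h3, h4, h5⟩ := hex
      have hγv := hnonadj γ h1 h2 h3 h4 h5
      obtain ⟨hs, hp⟩ := posRoots_eq_of_orthogonal hx {θ, α, β, γ} (by simp) (by
        simp only [Finset.mem_insert, Finset.mem_singleton]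
        rintro δ (rfl | rfl | rfl | rfl) <;> assumption) (by
        intro δ hδ hδD ε hε
        simp only [Finset.mem_insert, Finset.mem_singleton, not_or] at hδD hε
        obtain ⟨g1, g2, g3, g4⟩ := hδD
        have e1 := hrest δ hδ g1 g2 g3
        have e2 : δ (rootVec α) = 0 := by
          by_contra hc
          exact g4 (DFunLike.ext _ _ fun z => by rw [hγv, hnonadj δ hδ g1 g2 g3 hc])
        rcases hε with rfl | rfl | rfl | rfl
        · exact e1
        · exact e2
        · rw [hβvec, e1, e2, sub_zero]
        · rw [apply_rootVec_comm, hγv, apply_rootVec_comm β, hβvec, apply_rootVec_comm α, e1, e2]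
          simp)
      refine ⟨finrank_eq_two_of_span hθ hα hne hs ?_, .inr ?_⟩
      · intro δ hδ
        simp only [Finset.coe_insert, Finset.coe_singleton, Set.mem_insert_iff,
          Set.mem_singleton_iff] at hδ
        rcases hδ with rfl | rfl | rfl | rfl
        · exact hlin _ 0 1 (by simp)
        · exact hlin _ 1 0 (by simp)
        · exact hlin _ (-1) 1 fun z => by rw [hβv]; ring
        · exact hlin _ (-2) 1 fun z => by rw [hγv, hβv]; ring
      · rw [hp, Finset.card_insert_of_notMem, Finset.card_insert_of_notMem,
          Finset.card_insert_of_notMem, Finset.card_singleton]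
        · simpa using h4.symm
        · simp [hαβ, h3.symm]
        · simp [hne.symm, hβθ.symm, h2.symm]
    · push Not at hex
      obtain ⟨hs, hp⟩ := posRoots_eq_of_orthogonal hx {θ, α, β} (by simp) (by
        simp only [Finset.mem_insert, Finset.mem_singleton]
        rintro δ (rfl | rfl | rfl) <;> assumption) (by
        intro δ hδ hδD ε hε
        simp only [Finset.mem_insert, Finset.mem_singleton, not_or] at hδD hε
        obtain ⟨g1, g2, g3⟩ := hδD
        have e1 := hrest δ hδ g1 g2 g3
        have e2 := hex δ hδ g1 g2 g3
        rcases hε with rfl | rfl | rfl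
        · exact e1
        · exact e2
        · rw [hβvec, e1, e2, sub_zero])
      refine ⟨finrank_eq_two_of_span hθ hα hne hs ?_, .inl ?_⟩
      · intro δ hδ
        simp only [Finset.coe_insert, Finset.coe_singleton, Set.mem_insert_iff,
          Set.mem_singleton_iff] at hδ
        rcases hδ with rfl | rfl | rfl
        · exact hlin _ 0 1 (by simp)
        · exact hlin _ 1 0 (by simp)
        · exact hlin _ (-1) 1 fun z => by rw [hβv]; ring
      · rw [hp, Finset.card_insert_of_notMem, Finset.card_insert_of_notMem,
          Finset.card_singleton]
        · simpa using hαβ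
        · simp [hne.symm, hβθ.symm]

end Combinatorics

/-! ### Transport of symplectic structures -/

theorem LinearMap.BilinForm.IsAlt.nondegenerate_of_separating {V : Type*} [AddCommGroup V]
    [Module ℝ V] {ω : LinearMap.BilinForm ℝ V} (alt : ω.IsAlt)
    (h : ∀ u, (∀ v, ω u v = 0) → u = 0) : ω.Nondegenerate :=
  ⟨h, fun v hv => h v fun u => by rw [← alt.neg_eq u v, hv u, neg_zero]⟩

theorem AdmitsSymplectic.of_equiv {A B : Type*} [LieRing A] [LieAlgebra ℝ A] [LieRing B]
    [LieAlgebra ℝ B] (e : A ≃ₗ⁅ℝ⁆ B) (h : AdmitsSymplectic A) : AdmitsSymplectic B := by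
  obtain ⟨ω, alt, closed, nondeg⟩ := h
  have alt' : LinearMap.BilinForm.IsAlt
      (ω.compl₁₂ (e.symm : B →ₗ[ℝ] A) (e.symm : B →ₗ[ℝ] A)) := fun v => alt (e.symm v)
  refine ⟨_, alt', fun u v w => ?_, alt'.nondegenerate_of_separating fun u hu => ?_⟩
  · have := closed (e.symm u) (e.symm v) (e.symm w)
    rw [← LieEquiv.map_lie, ← LieEquiv.map_lie, ← LieEquiv.map_lie] at this
    exact this
  · have := nondeg.1 (e.symm u) fun v => by simpa using hu (e v)
    simpa using this

/-- The trivial extensions of isomorphic Lie algebras are isomorphic. -/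
noncomputable def trivialExtensionCongr {A B : Type*} [LieRing A] [LieAlgebra ℝ A] [LieRing B]
    [LieAlgebra ℝ B] (s : ℕ) (e : A ≃ₗ⁅ℝ⁆ B) : TrivialExtension s A ≃ₗ⁅ℝ⁆ TrivialExtension s B where
  __ := LinearEquiv.prodCongr (LinearEquiv.refl ℝ (AbelianLie s)) e.toLinearEquiv
  map_lie' {u v} := Prod.ext rfl (LieEquiv.map_lie e u.2 v.2)

theorem lie_abelianLie (s : ℕ) (u v : AbelianLie s) : ⁅u, v⁆ = 0 := rfl

/-! ### The nilradical of a minimal parabolic subalgebra -/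

section Nilradical

variable {L : Type*} [LieRing L] [LieAlgebra ℝ L] [FiniteDimensional ℝ L]
  {H : LieSubalgebra ℝ L} [H.IsCartanSubalgebra]

omit [FiniteDimensional ℝ L] in
theorem eq_zero_of_mem_rootSpace_of_mem_rootSum {x : H} {T : Set ℝ} {β : Weight ℝ H L}
    (hβ : β x ∉ T) {u : L} (hu : u ∈ rootSpace H β) (hu' : u ∈ rootSum x T) : u = 0 := by
  have hind := LieSubmodule.iSupIndep_toSubmodule.mpr (iSupIndep_genWeightSpace' ℝ H L)
  have hle : rootSum x T ≤ ⨆ (α : Weight ℝ H L) (_ : α ≠ β), (rootSpace H α).toSubmodule := by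
    refine iSup₂_le fun α hα => le_iSup₂_of_le α ?_ le_rfl
    rintro rfl
    exact hβ hα
  exact (Submodule.disjoint_def.mp (hind β)) u hu (hle hu')

theorem mem_rootSum_of_mem_cartan {x : H} {T : Set ℝ} (hT : (0 : ℝ) ∈ T) {u : L} (hu : u ∈ H) :
    u ∈ rootSum x T := by
  refine mem_rootSum (φ := 0) hT ?_
  rw [rootSpace_zero_eq]
  exact hu

/-- The positive root spaces, as an ideal of the parabolic subalgebra. -/
noncomputable def posIdeal (x : H) (p : LieSubalgebra ℝ L)
    (hp : p.toSubmodule = H.toSubmodule ⊔ rootSum x (Set.Ioi 0)) : LieIdeal ℝ p where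
  __ := (rootSum x (Set.Ioi 0)).comap p.toSubmodule.subtype
  lie_mem := by
    rintro ⟨u, hu⟩ ⟨v, hv⟩ hv'
    rw [← LieSubalgebra.mem_toSubmodule, hp] at hu
    refine lie_mem_rootSum (A := Set.Ici 0) (B := Set.Ioi 0)
      (fun a ha b hb => add_pos_of_nonneg_of_pos ha hb) ?_ hv'
    have hle : H.toSubmodule ⊔ rootSum x (Set.Ioi 0) ≤ rootSum x (Set.Ici 0) :=
      sup_le (fun u hu => mem_rootSum_of_mem_cartan (Set.mem_Ici.mpr le_rfl) hu)
        (iSup₂_le fun α hα u hu => mem_rootSum (Set.mem_Ici.mpr (le_of_lt hα)) hu)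
    exact hle hu

theorem mem_posIdeal {x : H} {p : LieSubalgebra ℝ L}
    {hp : p.toSubmodule = H.toSubmodule ⊔ rootSum x (Set.Ioi 0)} {u : p} :
    u ∈ posIdeal x p hp ↔ (u : L) ∈ rootSum x (Set.Ioi 0) := Iff.rfl

/-- By Engel's theorem it suffices that each `ad a` is nilpotent. It raises the value at `x` by at
least the least positive value `m`, and the values are bounded. -/
theorem isNilpotent_posIdeal {x : H} {p : LieSubalgebra ℝ L}
    (hp : p.toSubmodule = H.toSubmodule ⊔ rootSum x (Set.Ioi 0)) :
    LieRing.IsNilpotent (posIdeal x p hp) := by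
  rw [LieAlgebra.isNilpotent_iff_forall (R := ℝ)]
  intro a
  obtain ⟨m, hm0, hm⟩ : ∃ m : ℝ, 0 < m ∧ ∀ α : Weight ℝ H L, 0 < α x → m ≤ α x := by
    by_cases hne : (posRoots x : Finset (Weight ℝ H L)).Nonempty
    · obtain ⟨α, hα, hmin⟩ := Finset.exists_min_image _ (fun α : Weight ℝ H L => α x) hne
      exact ⟨α x, by simpa using hα, fun β hβ => hmin β (by simpa using hβ)⟩
    · refine ⟨1, one_pos, fun α hα => (hne ⟨α, by simpa using hα⟩).elim⟩
  obtain ⟨M, hM⟩ : ∃ M : ℝ, ∀ α : Weight ℝ H L, α x ≤ M := by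
    obtain ⟨M, hM⟩ := (Set.finite_range fun α : Weight ℝ H L => α x).bddAbove
    exact ⟨M, fun α => hM ⟨α, rfl⟩⟩
  have ha : (a : L) ∈ rootSum x (Set.Ici m) := by
    have hle : rootSum x (Set.Ioi 0) ≤ rootSum x (Set.Ici m) :=
      iSup₂_le fun α hα u hu => mem_rootSum (Set.mem_Ici.mpr (hm α hα)) hu
    exact hle a.2
  obtain ⟨k, hk⟩ := exists_nat_gt (M / m)
  refine ⟨k, LinearMap.ext fun y => ?_⟩
  have key : ∀ k : ℕ, (((ad ℝ (posIdeal x p hp) a ^ k) y : p) : L) ∈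
      rootSum x (Set.Ici (k * m)) := by
    intro k
    induction k with
    | zero =>
      have hle : rootSum x (Set.Ioi 0) ≤ rootSum x (Set.Ici (((0 : ℕ) : ℝ) * m)) :=
        iSup₂_le fun α hα u hu => mem_rootSum (by simpa using le_of_lt hα) hu
      exact hle y.2
    | succ k ih =>
      rw [pow_succ', Module.End.mul_apply]
      refine lie_mem_rootSum (A := Set.Ici m) (B := Set.Ici (k * m)) (fun u hu v hv => ?_) ha ih
      simp only [Set.mem_Ici] at *
      push_cast
      linarith
  have hbot : rootSum x (Set.Ici (k * m)) ≤ ⊥ := by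
    refine iSup₂_le fun α hα => ?_
    rw [div_lt_iff₀ hm0] at hk
    exact absurd (hM α) (not_le.mpr (hk.trans_le hα))
  have := hbot (key k)
  rw [Submodule.mem_bot] at this
  exact Subtype.ext (Subtype.ext this)

variable [IsTriangularizable ℝ H L] [IsKilling ℝ L]

/-- Write `a = h + n`. On a vector `e` of a positive root `β`, `ad a ^ k` acts as `β(h) ^ k` modulo
higher terms, so nilpotency forces `β(h) = 0`. All roots then vanish at `h`, whence `h = 0`. -/
theorem le_posIdeal_of_isNilpotent {x : H} (hx : ∀ α : Weight ℝ H L, α.IsNonZero → α x ≠ 0)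
    {p : LieSubalgebra ℝ L} (hp : p.toSubmodule = H.toSubmodule ⊔ rootSum x (Set.Ioi 0))
    (I : LieIdeal ℝ p) [LieRing.IsNilpotent I] : I ≤ posIdeal x p hp := by
  intro a ha
  rw [mem_posIdeal]
  have hap : (a : L) ∈ H.toSubmodule ⊔ rootSum x (Set.Ioi 0) := hp ▸ a.2
  obtain ⟨h, hh, n, hn, hsum⟩ := Submodule.mem_sup.mp hap
  have hpos : ∀ β : Weight ℝ H L, 0 < β x → β ⟨h, hh⟩ = 0 := by
    intro β hβ
    by_contra hne
    obtain ⟨e, he, he0⟩ := β.exists_ne_zero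
    have hep : e ∈ p := by
      rw [← LieSubalgebra.mem_toSubmodule, hp]
      exact Submodule.mem_sup_right (mem_rootSum hβ he)
    have ha0 : (a : L) ∈ rootSum x (Set.Ici 0) := by
      rw [← hsum]
      refine add_mem (mem_rootSum_of_mem_cartan (Set.mem_Ici.mpr le_rfl) hh) ?_
      have hle : rootSum x (Set.Ioi 0) ≤ rootSum x (Set.Ici 0) :=
        iSup₂_le fun α hα u hu => mem_rootSum (Set.mem_Ici.mpr (le_of_lt hα)) hu
      exact hle hn
    have key : ∀ k : ℕ, (ad ℝ L (a : L) ^ k) e - β ⟨h, hh⟩ ^ k • e ∈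
        rootSum x (Set.Ioi (β x)) := by
      intro k
      induction k with
      | zero => simp
      | succ k ih =>
        have h1 : ⁅(a : L), (ad ℝ L (a : L) ^ k) e - β ⟨h, hh⟩ ^ k • e⁆ ∈
            rootSum x (Set.Ioi (β x)) :=
          lie_mem_rootSum (A := Set.Ici 0) (B := Set.Ioi (β x))
            (fun u hu v hv => by simp only [Set.mem_Ici, Set.mem_Ioi] at *; linarith) ha0 ih
        have h2 : ⁅n, e⁆ ∈ rootSum x (Set.Ioi (β x)) :=
          lie_mem_rootSum (A := Set.Ioi 0) (B := {β x})
            (fun u hu v hv => by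
              simp only [Set.mem_singleton_iff, Set.mem_Ioi] at *; linarith) hn (mem_rootSum (φ := (β : H → ℝ)) (Set.mem_singleton _) he)
        have h3 : ⁅h, e⁆ = β ⟨h, hh⟩ • e := lie_eq_smul_of_mem_rootSpace he ⟨h, hh⟩
        have h4 : ⁅(a : L), e⁆ = β ⟨h, hh⟩ • e + ⁅n, e⁆ := by rw [← hsum, add_lie, h3]
        have h5 : (ad ℝ L (a : L) ^ (k + 1)) e - β ⟨h, hh⟩ ^ (k + 1) • e =
            ⁅(a : L), (ad ℝ L (a : L) ^ k) e - β ⟨h, hh⟩ ^ k • e⁆ + β ⟨h, hh⟩ ^ k • ⁅n, e⁆ := by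
          rw [pow_succ', Module.End.mul_apply, ad_apply, lie_sub, lie_smul, h4, pow_succ]
          module
        rw [h5]
        exact add_mem h1 (Submodule.smul_mem _ _ h2)
    obtain ⟨k, hk⟩ := (LieAlgebra.isNilpotent_iff_forall (R := ℝ) (L := I)).mp inferInstance ⟨a, ha⟩
    have hpow : ∀ (k : ℕ) (i : I), (ad ℝ L (a : L) ^ k) ((i : p) : L) =
        (((ad ℝ I ⟨a, ha⟩ ^ k) i : p) : L) := by
      intro k
      induction k with
      | zero => simp
      | succ k ih =>
        intro i
        rw [pow_succ', pow_succ', Module.End.mul_apply, Module.End.mul_apply, ih]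
        rfl
    have hI : ⁅a, (⟨e, hep⟩ : p)⁆ ∈ I := lie_mem_left ℝ p I a _ ha
    -- One extra power: `e` need not lie in `I`, but `⁅a, e⁆` does.
    have hz : (ad ℝ L (a : L) ^ (k + 1)) e = 0 := by
      have h6 := hpow k ⟨_, hI⟩
      rw [hk] at h6
      rw [pow_succ, Module.End.mul_apply]
      simpa using h6
    have h7 := key (k + 1)
    rw [hz, zero_sub, neg_mem_iff] at h7
    have h8 := eq_zero_of_mem_rootSpace_of_mem_rootSum (by simp) (Submodule.smul_mem _ _ he) h7
    exact smul_ne_zero (pow_ne_zero _ hne) he0 h8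
  have h0 : (⟨h, hh⟩ : H) = 0 := by
    have : (⟨h, hh⟩ : H) ∈ ⨅ α : Weight ℝ H L, α.ker := by
      refine (Submodule.mem_iInf _).mpr fun α => ?_
      by_cases hα : α.IsNonZero
      · rcases lt_or_gt_of_ne (hx α hα) with hlt | hlt
        · have := hpos (-α) (by simpa using hlt)
          simpa using this
        · simpa using hpos α hlt
      · have : (α : H → ℝ) = 0 := not_not.mp hα
        simp [this]
    simpa using this
  have : h = 0 := congrArg Subtype.val h0
  rw [← hsum, this, zero_add]
  exact hn

theorem lieNilradical_eq_posIdeal {x : H} (hx : ∀ α : Weight ℝ H L, α.IsNonZero → α x ≠ 0)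
    {p : LieSubalgebra ℝ L} (hp : p.toSubmodule = H.toSubmodule ⊔ rootSum x (Set.Ioi 0)) :
    lieNilradical p = posIdeal x p hp :=
  le_antisymm (sSup_le fun I hI => by
    have : LieRing.IsNilpotent I := hI
    exact le_posIdeal_of_isNilpotent hx hp I) (le_sSup (isNilpotent_posIdeal hp))

/-- The nilradical of a minimal parabolic subalgebra is the sum of the positive root spaces. -/
theorem nonempty_lieNilradical_equiv_posRootSubalgebra {x : H}
    (hx : ∀ α : Weight ℝ H L, α.IsNonZero → α x ≠ 0)
    {p : LieSubalgebra ℝ L} (hp : p.toSubmodule = H.toSubmodule ⊔ rootSum x (Set.Ioi 0)) :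
    Nonempty (lieNilradical p ≃ₗ⁅ℝ⁆ posRootSubalgebra x) := by
  rw [lieNilradical_eq_posIdeal hx hp]
  exact ⟨{ toFun := fun u => ⟨u.1.1, u.2⟩
           invFun := fun u => ⟨⟨u.1, by
              rw [← LieSubalgebra.mem_toSubmodule, hp]; exact Submodule.mem_sup_right u.2⟩, u.2⟩
           map_add' := fun _ _ => rfl
           map_smul' := fun _ _ => rfl
           map_lie' := rfl
           left_inv := fun _ => rfl
           right_inv := fun _ => rfl }⟩

end Nilradical

/-! ### Necessity: a symplectic form bounds the root system -/

section Forward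

variable {L : Type*} [LieRing L] [LieAlgebra ℝ L] [FiniteDimensional ℝ L]
  {H : LieSubalgebra ℝ L} [H.IsCartanSubalgebra] [IsTriangularizable ℝ H L] [IsSimple ℝ L]

/-- Without positive roots the dimension count gives `L = H`, which is abelian. -/
theorem exists_max_root {x : H} (hx : ∀ α : Weight ℝ H L, α.IsNonZero → α x ≠ 0) :
    ∃ θ : Weight ℝ H L, (∀ β : Weight ℝ H L, β x ≤ θ x) ∧ 0 < θ x := by
  have : Nontrivial L := IsSimple.nontrivial ℝ L
  obtain ⟨θ, hθ⟩ := Finite.exists_max fun α : Weight ℝ H L => α x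
  refine ⟨θ, hθ, ?_⟩
  have hrank := finrank_eq_finrank_add_two_mul_card hx
  by_contra hle
  have hempty : (posRoots x : Finset (Weight ℝ H L)) = ∅ := by
    ext α
    simp only [mem_posRoots, Finset.notMem_empty, iff_false, not_lt]
    exact (hθ α).trans (not_lt.mp hle)
  rw [hempty, Finset.card_empty, mul_zero, add_zero] at hrank
  have hH : H.toSubmodule = ⊤ := Submodule.eq_top_of_finrank_eq hrank.symm
  refine IsSimple.non_abelian ℝ (L := L) ⟨fun u v => ?_⟩
  have hu : u ∈ H := by rw [← LieSubalgebra.mem_toSubmodule, hH]; trivial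
  have hv : v ∈ H := by rw [← LieSubalgebra.mem_toSubmodule, hH]; trivial
  exact congrArg Subtype.val (trivial_lie_zero H H ⟨u, hu⟩ ⟨v, hv⟩)

/-- If a trivial extension of the sum of the positive root spaces of a simple split Lie algebra is
symplectic, then the root system is of type `A₁`, `A₂` or `B₂`, as far as the rank and the number of
roots are concerned. -/
theorem rank_and_card_of_admitsSymplectic {x : H}
    (hx : ∀ α : Weight ℝ H L, α.IsNonZero → α x ≠ 0) {s : ℕ}
    (h : AdmitsSymplectic (TrivialExtension s (posRootSubalgebra x))) :
    (finrank ℝ H = 1 ∧ (posRoots x).card = 1) ∨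
      (finrank ℝ H = 2 ∧ ((posRoots x).card = 3 ∨ (posRoots x).card = 4)) := by
  obtain ⟨θ, hmax, hθ⟩ := exists_max_root hx
  by_cases hθind : ∀ β γ : Weight ℝ H L, 0 < β x → 0 < γ x → (β + γ : H → ℝ) ≠ θ
  · exact .inl (finrank_eq_one_and_card_eq_one hx hmax hθ hθind)
  right
  have hθdec := hθind
  push Not at hθdec
  obtain ⟨b₁, b₂, hb₁, hb₂, hb⟩ := hθdec
  obtain ⟨ω, alt, closed, nondeg⟩ := h
  -- An arbitrary linear retraction onto the subalgebra extends `ω` to a form on `L`; closedness is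
  -- only needed, and only kept, on the subalgebra.
  obtain ⟨π, hπ⟩ := LinearMap.exists_leftInverse_of_injective (posRootSubalgebra x).toSubmodule.subtype
    (Submodule.ker_subtype _)
  have hπ' : ∀ u : posRootSubalgebra x, π (u : L) = u := fun u => LinearMap.congr_fun hπ u
  let ι : L →ₗ[ℝ] TrivialExtension s (posRootSubalgebra x) :=
    (LinearMap.inr ℝ (AbelianLie s) (posRootSubalgebra x)).comp π
  have hιval : ∀ u : posRootSubalgebra x, ι (u : L) = (0, u) := fun u => by
    show ((0, π u) : TrivialExtension s (posRootSubalgebra x)) = _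
    rw [hπ']
  let Ω : LinearMap.BilinForm ℝ L := ω.compl₁₂ ι ι
  have hΩ : ∀ u v, Ω u v = ω (ι u) (ι v) := fun u v => rfl
  have altΩ : Ω.IsAlt := fun u => alt (ι u)
  have hlie : ∀ u ∈ posRootSubalgebra x, ∀ v ∈ posRootSubalgebra x, ι ⁅u, v⁆ = ⁅ι u, ι v⁆ := by
    intro u hu v hv
    have h1 := hιval ⟨⁅u, v⁆, (posRootSubalgebra x).lie_mem hu hv⟩
    have h2 := hιval ⟨u, hu⟩
    have h3 := hιval ⟨v, hv⟩
    simp only at h1 h2 h3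
    rw [h1, h2, h3]
    exact Prod.ext rfl rfl
  have closedΩ : ∀ u ∈ (posRootSubalgebra x).toSubmodule, ∀ v ∈ (posRootSubalgebra x).toSubmodule,
      ∀ w ∈ (posRootSubalgebra x).toSubmodule, Ω ⁅u, v⁆ w - Ω ⁅u, w⁆ v + Ω ⁅v, w⁆ u = 0 := by
    intro u hu v hv w hw
    simp only [hΩ, hlie u hu v hv, hlie u hu w hw, hlie v hv w hw]
    exact closed _ _ _
  have hN : ∀ β : Weight ℝ H L, 0 < β x →
      (rootSpace H β).toSubmodule ≤ (posRootSubalgebra x).toSubmodule :=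
    fun β hβ u hu => mem_rootSum hβ hu
  have hcomm : ∀ eθ ∈ rootSpace H θ, ∀ u ∈ (posRootSubalgebra x).toSubmodule, ⁅eθ, u⁆ = 0 := by
    intro eθ heθ u hu
    have h1 : ⁅eθ, u⁆ ∈ rootSum x (Set.Ioi (θ x)) :=
      lie_mem_rootSum (A := {θ x}) (B := Set.Ioi 0) (fun a ha b hb => by
        simp only [Set.mem_singleton_iff, Set.mem_Ioi] at *; linarith) (mem_rootSum (φ := (θ : H → ℝ)) (Set.mem_singleton _) heθ) hu
    have hbot : rootSum x (Set.Ioi (θ x)) ≤ ⊥ :=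
      iSup₂_le fun α hα => absurd (hmax α) (not_le.mpr hα)
    simpa using hbot h1
  obtain ⟨eθ, heθ, heθ0⟩ := θ.exists_ne_zero
  -- Root spaces are lines and the bracket of root vectors is nonzero here, so every vector of a
  -- decomposable root is a commutator.
  have hlieN : ∀ β γ δ : Weight ℝ H L, 0 < β x → 0 < γ x → (β + γ : H → ℝ) = δ →
      ∀ w ∈ rootSpace H δ, ∃ u ∈ rootSpace H β, ∃ v ∈ rootSpace H γ, ⁅u, v⁆ = w := by
    intro β γ δ hβ hγ hδ w hw
    obtain ⟨u, hu, hu0⟩ := β.exists_ne_zero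
    obtain ⟨v, hv, hv0⟩ := γ.exists_ne_zero
    have hne := lie_ne_zero_of_rootSpace_add_ne_bot (isNonZero_of_apply_pos hβ)
      (isNonZero_of_apply_pos hγ) (hδ ▸ δ.genWeightSpace_ne_bot L) hu hu0 hv hv0
    have hδx : 0 < δ x := by rw [← hδ]; exact add_pos hβ hγ
    obtain ⟨c, hc⟩ := smul_eq_of_mem_rootSpace (isNonZero_of_apply_pos hδx)
      (hδ ▸ lie_mem_genWeightSpace_of_mem_genWeightSpace hu hv) hne hw
    exact ⟨c • u, Submodule.smul_mem _ _ hu, v, hv, by rw [smul_lie, hc]⟩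
  by_cases hex : ∃ α : Weight ℝ H L, 0 < α x ∧
      (∀ β γ : Weight ℝ H L, 0 < β x → 0 < γ x → (β + γ : H → ℝ) ≠ α) ∧
      ∃ eα ∈ rootSpace H α, Ω eθ eα ≠ 0
  · obtain ⟨α, hα, hind, eα, heα, hne⟩ := hex
    have hαθ : α ≠ θ := by
      rintro rfl
      exact hθind hind
    have hsum := (mul_eq_zero.mp (sum_apply_rootVec_mul_eq_zero hx hmax hα hind hN Ω altΩ closedΩ
      heθ heα)).resolve_right hne
    exact finrank_eq_two_and_card hx hmax hθ hα hind hαθ hsum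
  · exfalso
    push Not at hex
    have h1 : ∀ v ∈ (posRootSubalgebra x).toSubmodule, Ω eθ v = 0 := by
      intro v hv
      refine rootSum_induction (p := fun v => Ω eθ v = 0) (fun δ hδ w hw => ?_) (by simp)
        (fun u v hu hv => by rw [map_add, hu, hv, add_zero]) hv
      by_cases hind : ∀ β γ : Weight ℝ H L, 0 < β x → 0 < γ x → (β + γ : H → ℝ) ≠ δ
      · exact hex δ hδ hind w hw
      · push Not at hind
        obtain ⟨β, γ, hβ, hγ, hsum⟩ := hind
        obtain ⟨u, hu, v, hv, rfl⟩ := hlieN β γ δ hβ hγ hsum w hw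
        have := closedΩ u (hN β hβ hu) v (hN γ hγ hv) eθ (hN θ hθ heθ)
        rw [← lie_skew u eθ, hcomm eθ heθ u (hN β hβ hu), ← lie_skew v eθ,
          hcomm eθ heθ v (hN γ hγ hv)] at this
        simp only [neg_zero, map_zero, LinearMap.zero_apply, sub_zero, add_zero] at this
        rw [← altΩ.neg_eq, this, neg_zero]
    -- Since `eθ` is itself a commutator, closedness against the central vector `y` gives
    -- orthogonality to the abelian factor.
    have h2 : ∀ y : AbelianLie s, ω (ι eθ) (y, 0) = 0 := by
      intro y
      obtain ⟨u, hu, v, hv, huv⟩ := hlieN b₁ b₂ θ hb₁ hb₂ hb eθ heθ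
      have huN := hN b₁ hb₁ hu
      have hvN := hN b₂ hb₂ hv
      have h3 := closed (ι u) (ι v) (y, 0)
      have h4 : ∀ z : L, ⁅ι z, ((y, 0) : TrivialExtension s (posRootSubalgebra x))⁆ = 0 := fun z =>
        Prod.ext (lie_abelianLie s _ _) (lie_zero _)
      rw [h4, h4, ← hlie u huN v hvN, huv] at h3
      simpa using h3
    have h3 : ι eθ = 0 := by
      refine nondeg.1 _ fun v => ?_
      obtain ⟨y, v⟩ := v
      have : ((y, v) : TrivialExtension s (posRootSubalgebra x)) = (y, 0) + ι (v : L) := by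
        rw [hιval]; exact Prod.ext (add_zero y).symm (zero_add v).symm
      rw [this, map_add, h2, zero_add]
      exact h1 v v.2
    have h4 := hιval ⟨eθ, hN θ hθ heθ⟩
    rw [h3] at h4
    exact heθ0 (congrArg (fun z : TrivialExtension s (posRootSubalgebra x) => (z.2 : L)) h4).symm

end Forward

/-! ### Explicit symplectic forms -/

section Construction

variable {L : Type*} [LieRing L] [LieAlgebra ℝ L]

/-- The standard two-form in the coordinates of a basis split into two halves is a symplectic
structure as soon as it is closed. -/
theorem admitsSymplectic_of_closed {κ : Type*} [Fintype κ] (b : Basis (κ ⊕ κ) ℝ L)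
    (closed : ∀ u v w : L,
      ∑ i, (b.coord (.inl i) ⁅u, v⁆ * b.coord (.inr i) w -
          b.coord (.inr i) ⁅u, v⁆ * b.coord (.inl i) w) -
        ∑ i, (b.coord (.inl i) ⁅u, w⁆ * b.coord (.inr i) v -
          b.coord (.inr i) ⁅u, w⁆ * b.coord (.inl i) v) +
        ∑ i, (b.coord (.inl i) ⁅v, w⁆ * b.coord (.inr i) u -
          b.coord (.inr i) ⁅v, w⁆ * b.coord (.inl i) u) = 0) :
    AdmitsSymplectic L := by
  classical
  let ω : LinearMap.BilinForm ℝ L := ∑ i : κ,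
    ((LinearMap.mul ℝ ℝ).compl₁₂ (b.coord (.inl i)) (b.coord (.inr i)) -
      (LinearMap.mul ℝ ℝ).compl₁₂ (b.coord (.inr i)) (b.coord (.inl i)))
  have hω : ∀ u v, ω u v = ∑ i, (b.coord (.inl i) u * b.coord (.inr i) v -
      b.coord (.inr i) u * b.coord (.inl i) v) := by
    intro u v
    simp [ω, LinearMap.sum_apply]
  have alt : ω.IsAlt := by
    intro u
    rw [hω]
    exact Finset.sum_eq_zero fun i _ => by ring
  refine ⟨ω, alt, fun u v w => ?_, alt.nondegenerate_of_separating fun u hu => ?_⟩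
  · simp only [hω]
    exact closed u v w
  · refine b.ext_elem fun j => ?_
    rcases j with j | j
    · have := hu (b (.inr j))
      rw [hω] at this
      simpa [Finsupp.single_apply] using this
    · have := hu (b (.inl j))
      rw [hω] at this
      simpa [Finsupp.single_apply] using this

theorem admitsSymplectic_of_isLieAbelian [FiniteDimensional ℝ L] [IsLieAbelian L]
    (h : Even (finrank ℝ L)) : AdmitsSymplectic L := by
  obtain ⟨k, hk⟩ := h
  refine admitsSymplectic_of_closed
    ((finBasisOfFinrankEq ℝ L hk).reindex finSumFinEquiv.symm) fun u v w => ?_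
  simp only [trivial_lie_zero, map_zero, zero_mul, sub_zero, Finset.sum_const_zero, add_zero]

theorem injective_vecCons_four {ι : Type*} {a b c d : ι} (hab : a ≠ b) (hac : a ≠ c) (had : a ≠ d)
    (hbc : b ≠ c) (hbd : b ≠ d) (hcd : c ≠ d) : Function.Injective ![a, b, c, d] := by
  intro i j hij
  fin_cases i <;> fin_cases j <;> simp_all

/-- Parity: after four distinguished indices are removed, an even number remains and splits into two
halves to be paired. -/
theorem exists_sum_equiv_extending {ι : Type*} [Fintype ι] (h : Even (Fintype.card ι))
    (i : Fin 4 ↪ ι) : ∃ (k : ℕ) (e : Fin 4 ⊕ (Fin k ⊕ Fin k) ≃ ι), ∀ j, e (.inl j) = i j := by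
  classical
  have hc : Fintype.card ι = 4 + Fintype.card ↥(Set.range i)ᶜ := by
    rw [← Fintype.card_congr (Equiv.Set.sumCompl (Set.range i)), Fintype.card_sum,
      Set.card_range_of_injective i.injective, Fintype.card_fin]
  obtain ⟨m, hm⟩ := h
  have hk : Fintype.card ↥(Set.range i)ᶜ = Fintype.card (Fin (m - 2) ⊕ Fin (m - 2)) := by
    rw [Fintype.card_sum, Fintype.card_fin]; omega
  refine ⟨m - 2, ((Equiv.ofInjective i i.injective).sumCongr (Fintype.equivOfCardEq hk).symm).trans
    (Equiv.Set.sumCompl (Set.range i)), fun j => by simp⟩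

/-- A Lie algebra of even dimension with a basis whose only possibly nonzero brackets are
`⁅b₂, b₁⁆ = c b₀` and `⁅b₂, b₃⁆ = d b₁` is symplectic. -/
theorem admitsSymplectic_of_basis {ι : Type*} [Fintype ι] (b : Basis ι ℝ L)
    (heven : Even (Fintype.card ι)) (i : Fin 4 ↪ ι) {c d : ℝ}
    (h21 : ⁅b (i 2), b (i 1)⁆ = c • b (i 0)) (h23 : ⁅b (i 2), b (i 3)⁆ = d • b (i 1))
    (h13 : ⁅b (i 1), b (i 3)⁆ = 0) (h0 : ∀ j, ⁅b (i 0), b j⁆ = 0)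
    (hcent : ∀ j, j ∉ Set.range i → ∀ l, ⁅b j, b l⁆ = 0) : AdmitsSymplectic L := by
  obtain ⟨k, e, he⟩ := exists_sum_equiv_extending heven i
  have center : ∀ j, (∀ l, ⁅b j, b l⁆ = 0) → ∀ v : L, ⁅b j, v⁆ = 0 := by
    intro j hj v
    rw [← b.sum_repr v, lie_sum]
    exact Finset.sum_eq_zero fun l _ => by rw [lie_smul, hj, smul_zero]
  have center' : ∀ j, (∀ l, ⁅b j, b l⁆ = 0) → ∀ v : L, ⁅v, b j⁆ = 0 := by
    intro j hj v
    rw [← lie_skew, center j hj, neg_zero]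
  have hr : ∀ j, ∀ l, ⁅b (e (.inr j)), b l⁆ = 0 := by
    intro j
    refine hcent _ ?_
    rintro ⟨m, hm⟩
    rw [← he m] at hm
    simpa using e.injective hm
  have hdecomp : ∀ u : L, ∃ r : L, (∀ v : L, ⁅r, v⁆ = 0) ∧ u = b.repr u (i 0) • b (i 0) +
      b.repr u (i 1) • b (i 1) + b.repr u (i 2) • b (i 2) + b.repr u (i 3) • b (i 3) + r := by
    intro u
    refine ⟨∑ j, b.repr u (e (.inr j)) • b (e (.inr j)), fun v => ?_, ?_⟩
    · rw [sum_lie]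
      exact Finset.sum_eq_zero fun l _ => by rw [smul_lie, center _ (hr l), smul_zero]
    · conv_lhs => rw [← b.sum_repr u, ← e.sum_comp, Fintype.sum_sum_type]
      simp [he, Fin.sum_univ_four]
  have hbr : ∀ u v : L, ⁅u, v⁆ =
      (c * (b.repr u (i 2) * b.repr v (i 1) - b.repr u (i 1) * b.repr v (i 2))) • b (i 0) +
      (d * (b.repr u (i 2) * b.repr v (i 3) - b.repr u (i 3) * b.repr v (i 2))) • b (i 1) := by
    intro u v
    obtain ⟨r, hr, hu⟩ := hdecomp u
    obtain ⟨r', hr', hv⟩ := hdecomp v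
    have hr'' : ∀ w : L, ⁅w, r'⁆ = 0 := fun w => by rw [← lie_skew, hr', neg_zero]
    have h12 : ⁅b (i 1), b (i 2)⁆ = -(c • b (i 0)) := by rw [← lie_skew, h21]
    have h32 : ⁅b (i 3), b (i 2)⁆ = -(d • b (i 1)) := by rw [← lie_skew, h23]
    have h31 : ⁅b (i 3), b (i 1)⁆ = 0 := by rw [← lie_skew, h13, neg_zero]
    conv_lhs => rw [hu, hv]
    simp only [add_lie, lie_add, hr, hr'', smul_lie, lie_smul, center _ h0, center' _ h0, h12, h13,
      h23, h21, h31, h32, lie_self]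
    module
  -- Pair `b₀` with `b₂` and `b₁` with `b₃`. Then `d b₀*` is a multiple of `b₂* ∧ b₁*`, killed by
  -- `b₂*`, and `d b₁*` a multiple of `b₂* ∧ b₃*`, killed by `b₃*`; the other coordinates are
  -- closed.
  let g : (Fin 2 ⊕ Fin k) ⊕ (Fin 2 ⊕ Fin k) ≃ ι :=
    (Equiv.sumSumSumComm (Fin 2) (Fin k) (Fin 2) (Fin k)).trans
      ((Equiv.sumCongr finSumFinEquiv (Equiv.refl _)).trans e)
  have g0 : g (.inl (.inl 0)) = i 0 := he 0
  have g1 : g (.inl (.inl 1)) = i 1 := he 1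
  have g2 : g (.inr (.inl 0)) = i 2 := he 2
  have g3 : g (.inr (.inl 1)) = i 3 := he 3
  have gl : ∀ j, ∀ l, i l ≠ g (.inl (.inr j)) := fun j l h => by
    rw [← he l] at h
    exact Sum.inl_ne_inr (e.injective h)
  have gr : ∀ j, ∀ l, i l ≠ g (.inr (.inr j)) := fun j l h => by
    rw [← he l] at h
    exact Sum.inl_ne_inr (e.injective h)
  refine admitsSymplectic_of_closed (b.reindex g.symm) fun u v w => ?_
  have k0 : ∀ u v : L, b.repr ⁅u, v⁆ (i 0) =
      c * (b.repr u (i 2) * b.repr v (i 1) - b.repr u (i 1) * b.repr v (i 2)) := by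
    intro u v; rw [hbr u v]
    simp
  have k1 : ∀ u v : L, b.repr ⁅u, v⁆ (i 1) =
      d * (b.repr u (i 2) * b.repr v (i 3) - b.repr u (i 3) * b.repr v (i 2)) := by
    intro u v; rw [hbr u v]
    simp
  have k2 : ∀ u v : L, b.repr ⁅u, v⁆ (i 2) = 0 := by
    intro u v; rw [hbr u v]
    simp
  have k3 : ∀ u v : L, b.repr ⁅u, v⁆ (i 3) = 0 := by
    intro u v; rw [hbr u v]
    simp
  have kl : ∀ u v : L, ∀ j, b.repr ⁅u, v⁆ (g (.inl (.inr j))) = 0 := by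
    intro u v j; rw [hbr u v]
    simp [gl]
  have kr : ∀ u v : L, ∀ j, b.repr ⁅u, v⁆ (g (.inr (.inr j))) = 0 := by
    intro u v j; rw [hbr u v]
    simp [gr]
  simp only [Basis.coord_apply, Basis.repr_reindex_apply, Equiv.symm_symm, Fintype.sum_sum_type,
    Fin.sum_univ_two, g0, g1, g2, g3, kl, kr, k0, k1, k2, k3, zero_mul, sub_zero,
    Finset.sum_const_zero, add_zero]
  ring

end Construction

/-! ### Sufficiency: one, three or four positive roots -/

section Converse

variable {L : Type*} [LieRing L] [LieAlgebra ℝ L] [FiniteDimensional ℝ L]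
  {H : LieSubalgebra ℝ L} [H.IsCartanSubalgebra]

/-- A basis of the sum of the positive root spaces consisting of root vectors. -/
theorem exists_basis_posRootSubalgebra [IsTriangularizable ℝ H L] [IsKilling ℝ L] (x : H) :
    ∃ b : Basis {α : Weight ℝ H L // 0 < α x} ℝ (posRootSubalgebra x),
      ∀ α : {α : Weight ℝ H L // 0 < α x}, (b α : L) ∈ rootSpace H α.1 := by
  choose e he he0 using fun α : Weight ℝ H L => α.exists_ne_zero
  let v : {α : Weight ℝ H L // 0 < α x} → posRootSubalgebra x := fun α =>
    ⟨e α, mem_rootSum (φ := (α.1 : H → ℝ)) α.2 (he α)⟩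
  have hli : LinearIndependent ℝ v := by
    have hind := LieSubmodule.iSupIndep_toSubmodule.mpr (iSupIndep_genWeightSpace' ℝ H L)
    have h1 : LinearIndependent ℝ e := hind.linearIndependent _ he he0
    have h2 := h1.comp (fun α : {α : Weight ℝ H L // 0 < α x} => (α : Weight ℝ H L))
      Subtype.val_injective
    exact LinearIndependent.of_comp (posRootSubalgebra x).toSubmodule.subtype h2
  have hsp : ⊤ ≤ Submodule.span ℝ (Set.range v) := by
    rintro ⟨u, hu⟩ -
    have := rootSum_induction
      (p := fun u => ∃ hu : u ∈ posRootSubalgebra x, (⟨u, hu⟩ : posRootSubalgebra x) ∈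
        Submodule.span ℝ (Set.range v)) (fun α hα w hw => ?_) ⟨zero_mem _, zero_mem _⟩
        (fun u v ⟨h1, h2⟩ ⟨h3, h4⟩ => ⟨add_mem h1 h3, add_mem h2 h4⟩) hu
    · exact this.2
    · refine ⟨mem_rootSum hα hw, ?_⟩
      obtain ⟨c, rfl⟩ := smul_eq_of_mem_rootSpace (isNonZero_of_apply_pos hα) (he α) (he0 α) hw
      have h1 : v ⟨α, hα⟩ ∈ Submodule.span ℝ (Set.range v) := Submodule.subset_span ⟨_, rfl⟩
      exact Submodule.smul_mem _ c h1
  exact ⟨Basis.mk hli hsp, fun α => by rw [Basis.mk_apply]; exact he α⟩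

/-- The standard basis of `ℝ^s`. -/
noncomputable def abelianLieBasis (s : ℕ) : Basis (Fin s) ℝ (AbelianLie s) :=
  Pi.basisFun ℝ (Fin s)

variable [IsTriangularizable ℝ H L] [IsSimple ℝ L]

omit [IsTriangularizable ℝ H L] [IsSimple ℝ L] in
theorem card_subtype_eq_card_posRoots (x : H) :
    Fintype.card {α : Weight ℝ H L // 0 < α x} = (posRoots x : Finset (Weight ℝ H L)).card := by
  classical
  rw [Fintype.card_subtype]
  congr

/-- The positive roots span the dual of `H`, so `1 ≤ r ≤ N`. Under this constraint the only
solutions are `3 = 1 + 2·1`, `8 = 2 + 2·3` and `10 = 2 + 2·4`. -/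
theorem posRoots_card_eq_one_or_three_or_four {x : H}
    (hx : ∀ α : Weight ℝ H L, α.IsNonZero → α x ≠ 0)
    (h : finrank ℝ L = 3 ∨ finrank ℝ L = 8 ∨ finrank ℝ L = 10) :
    (posRoots x : Finset (Weight ℝ H L)).card = 1 ∨
      (posRoots x : Finset (Weight ℝ H L)).card = 3 ∨
      (posRoots x : Finset (Weight ℝ H L)).card = 4 := by
  classical
  have : Nontrivial L := IsSimple.nontrivial ℝ L
  have hrank := finrank_eq_finrank_add_two_mul_card hx
  have hle : finrank ℝ H ≤ (posRoots x : Finset (Weight ℝ H L)).card := by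
    have hspan : Submodule.span ℝ
        (((posRoots x).image (Weight.toLinear ℝ H L) : Finset (Dual ℝ H)) : Set (Dual ℝ H)) = ⊤ := by
      rw [← top_le_iff, ← span_weight_isNonZero_eq_top ℝ L H, Submodule.span_le]
      rintro _ ⟨α, hα, rfl⟩
      rcases lt_or_gt_of_ne (hx α hα) with hlt | hlt
      · have h1 : (-α).toLinear ∈ Submodule.span ℝ (((posRoots x).image
            (Weight.toLinear ℝ H L) : Finset (Dual ℝ H)) : Set (Dual ℝ H)) :=
          Submodule.subset_span (Finset.mem_image_of_mem _ (by simpa using hlt))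
        rw [Weight.toLinear_neg, neg_mem_iff] at h1
        exact h1
      · exact Submodule.subset_span (Finset.mem_image_of_mem _ (by simpa using hlt))
    rw [← Subspace.dual_finrank_eq, ← finrank_top ℝ (Dual ℝ H), ← hspan]
    exact (finrank_span_finset_le_card _).trans Finset.card_image_le
  obtain ⟨θ, -, hθ⟩ := exists_max_root hx
  have hpos : 0 < finrank ℝ H := by
    rw [Module.finrank_pos_iff, nontrivial_iff]
    have hθ0 : θ 0 = 0 := by
      rw [← Weight.toLinear_apply, map_zero]
    exact ⟨x, 0, fun h0 => by rw [h0, hθ0] at hθ; exact lt_irrefl _ hθ⟩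
  omega

set_option maxHeartbeats 1000000 in
-- Apart from `⁅e_α, e_β⁆` in the line of `e_θ`, at most one more bracket of basis vectors can be
-- nonzero, up to order. The structure constants `c` and `d` may be arbitrary, as closedness does
-- not depend on them.
theorem admitsSymplectic_of_card {x : H} (hx : ∀ α : Weight ℝ H L, α.IsNonZero → α x ≠ 0)
    {s : ℕ} (heven : Even (finrank ℝ (TrivialExtension s (posRootSubalgebra x))))
    (hcard : (posRoots x : Finset (Weight ℝ H L)).card = 1 ∨
      (posRoots x : Finset (Weight ℝ H L)).card = 3 ∨
      (posRoots x : Finset (Weight ℝ H L)).card = 4) :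
    AdmitsSymplectic (TrivialExtension s (posRootSubalgebra x)) := by
  classical
  obtain ⟨b, hb⟩ := exists_basis_posRootSubalgebra x
  let B := (abelianLieBasis s).prod b
  have hBl : ∀ j, B (.inl j) = (abelianLieBasis s j, 0) := fun j => by simp [B]
  have hBr : ∀ j, B (.inr j) = (0, b j) := fun j => by simp [B]
  have hcardB : Even (Fintype.card (Fin s ⊕ {α : Weight ℝ H L // 0 < α x})) := by
    rwa [← finrank_eq_card_basis B]
  have hcard' := card_subtype_eq_card_posRoots x (L := L)
  have hlie : ∀ α β, ⁅B (.inr α), B (.inr β)⁆ = (0, ⁅b α, b β⁆) := fun α β => by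
    rw [hBr, hBr]; exact Prod.ext (lie_abelianLie _ _ _) rfl
  have hleft : ∀ (j : Fin s) (v : TrivialExtension s (posRootSubalgebra x)), ⁅B (.inl j), v⁆ = 0 :=
    fun j v => by rw [hBl]; exact Prod.ext (lie_abelianLie _ _ _) (zero_lie _)
  have hright : ∀ (j : Fin s) (v : TrivialExtension s (posRootSubalgebra x)), ⁅v, B (.inl j)⁆ = 0 :=
    fun j v => by rw [hBl]; exact Prod.ext (lie_abelianLie _ _ _) (lie_zero _)
  have hzero : ∀ α β : {α : Weight ℝ H L // 0 < α x},
      (∀ γ : {α : Weight ℝ H L // 0 < α x}, (α.1 + β.1 : H → ℝ) ≠ γ.1) →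
        ⁅B (.inr α), B (.inr β)⁆ = 0 := by
    intro α β h
    rw [hlie]
    refine Prod.ext rfl (Subtype.ext ?_)
    have h1 : ⁅(b α : L), (b β : L)⁆ ∈ rootSpace H (α.1 + β.1 : H → ℝ) :=
      lie_mem_genWeightSpace_of_mem_genWeightSpace (hb α) (hb β)
    by_cases h0 : rootSpace H (α.1 + β.1 : H → ℝ) = ⊥
    · simpa [h0] using h1
    · exact (h ⟨⟨_, h0⟩, add_pos α.2 β.2⟩ rfl).elim
  have hmul : ∀ α β γ : {α : Weight ℝ H L // 0 < α x}, (α.1 + β.1 : H → ℝ) = γ.1 →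
      ∃ c : ℝ, ⁅B (.inr α), B (.inr β)⁆ = c • B (.inr γ) := by
    intro α β γ h
    have h1 : ⁅(b α : L), (b β : L)⁆ ∈ rootSpace H (α.1 + β.1 : H → ℝ) :=
      lie_mem_genWeightSpace_of_mem_genWeightSpace (hb α) (hb β)
    rw [h] at h1
    obtain ⟨c, hc⟩ := smul_eq_of_mem_rootSpace (isNonZero_of_apply_pos γ.2) (hb γ)
      (by simpa using b.ne_zero γ) h1
    refine ⟨c, ?_⟩
    rw [hlie, hBr]
    exact Prod.ext (smul_zero c).symm (Subtype.ext hc.symm)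
  obtain ⟨θ, hmax, hθ⟩ := exists_max_root hx
  have hθB : ∀ j, ⁅B (.inr ⟨θ, hθ⟩), B j⁆ = 0 := by
    rintro (j | β)
    · exact hright _ _
    · refine hzero _ _ fun γ h => ?_
      have h1 := hmax γ.1
      rw [← h] at h1
      have h2 := β.2
      simp at h1
      linarith
  by_cases h1 : (posRoots x : Finset (Weight ℝ H L)).card = 1
  · have hone : ∀ α : {α : Weight ℝ H L // 0 < α x}, α = ⟨θ, hθ⟩ := by
      have := Fintype.card_le_one_iff.mp (hcard'.trans h1).le
      exact fun α => this _ _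
    have hz : ∀ i j, ⁅B i, B j⁆ = 0 := by
      rintro (i | i) j
      · exact hleft _ _
      · rw [hone i]; exact hθB j
    have : IsLieAbelian (TrivialExtension s (posRootSubalgebra x)) := ⟨fun u v => by
      rw [← B.sum_repr u, ← B.sum_repr v, sum_lie_sum]
      exact Finset.sum_eq_zero fun i _ => Finset.sum_eq_zero fun j _ => by
        rw [smul_lie, lie_smul, hz, smul_zero, smul_zero]⟩
    have := B.finiteDimensional_of_finite
    exact admitsSymplectic_of_isLieAbelian heven
  have hdec : ∃ α β : {α : Weight ℝ H L // 0 < α x}, (α.1 + β.1 : H → ℝ) = θ := by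
    by_contra! hind
    exact h1 (finrank_eq_one_and_card_eq_one hx hmax hθ
      fun β γ hβ hγ => hind ⟨β, hβ⟩ ⟨γ, hγ⟩).2
  obtain ⟨α, β, hαβ⟩ := hdec
  have hval : ∀ z, θ z = α.1 z + β.1 z := fun z => (congrFun hαβ z).symm
  have hneαβ : α ≠ β := by
    rintro rfl
    exact θ.genWeightSpace_ne_bot L
      (rootSpace_eq_bot_of_eq_two_smul (isNonZero_of_apply_pos α.2) hαβ.symm)
  have hneα : α ≠ ⟨θ, hθ⟩ := by
    rintro rfl
    have := hval x
    have := β.2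
    simp only at *
    linarith
  have hneβ : β ≠ ⟨θ, hθ⟩ := by
    rintro rfl
    have := hval x
    have := α.2
    simp only at *
    linarith
  rcases hcard.resolve_left h1 with h3 | h4
  · have hs : 0 < s := by
      rw [Fintype.card_sum, Fintype.card_fin, hcard', h3] at hcardB
      rcases Nat.eq_zero_or_pos s with rfl | h
      · exact absurd hcardB (by decide)
      · exact h
    obtain ⟨c, hc⟩ := hmul α β ⟨θ, hθ⟩ hαβ
    let f : Fin 4 → Fin s ⊕ {α : Weight ℝ H L // 0 < α x} :=
      ![.inr ⟨θ, hθ⟩, .inr β, .inr α, .inl ⟨0, hs⟩]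
    have hf : Function.Injective f := by
      apply injective_vecCons_four <;> simp [hneα.symm, hneβ.symm, hneαβ.symm]
    have hall : ∀ γ : {α : Weight ℝ H L // 0 < α x}, γ = ⟨θ, hθ⟩ ∨ γ = β ∨ γ = α := by
      have hu : ({⟨θ, hθ⟩, β, α} : Finset {α : Weight ℝ H L // 0 < α x}) = Finset.univ := by
        rw [← Finset.card_eq_iff_eq_univ, hcard', h3, Finset.card_insert_of_notMem,
          Finset.card_insert_of_notMem, Finset.card_singleton]
        · simpa using hneαβ.symm
        · simp [hneα.symm, hneβ.symm]
      intro γ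
      have := Finset.mem_univ γ
      rw [← hu] at this
      simpa using this
    refine admitsSymplectic_of_basis B hcardB ⟨f, hf⟩ (c := c) (d := 0) hc ?_ ?_ hθB ?_
    · exact (hright _ _).trans (zero_smul _ _).symm
    · exact hright _ _
    · rintro (j | γ) hj l
      · exact hleft _ _
      · exfalso
        rcases hall γ with rfl | rfl | rfl
        · exact hj ⟨0, rfl⟩
        · exact hj ⟨1, rfl⟩
        · exact hj ⟨2, rfl⟩
  · obtain ⟨γ, hγθ, hγα, hγβ⟩ : ∃ γ : {α : Weight ℝ H L // 0 < α x},
        γ ≠ ⟨θ, hθ⟩ ∧ γ ≠ α ∧ γ ≠ β := by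
      by_contra! hno
      have hu : (Finset.univ : Finset {α : Weight ℝ H L // 0 < α x}) ⊆ {⟨θ, hθ⟩, α, β} := by
        intro γ _
        simp only [Finset.mem_insert, Finset.mem_singleton]
        by_contra! h
        exact h.2.2 (hno γ h.1 h.2.1)
      have := (Finset.card_le_card hu).trans Finset.card_le_three
      rw [Finset.card_univ, hcard', h4] at this
      omega
    have hu : ({⟨θ, hθ⟩, β, α, γ} : Finset {α : Weight ℝ H L // 0 < α x}) = Finset.univ := by
      rw [← Finset.card_eq_iff_eq_univ, hcard', h4, Finset.card_insert_of_notMem,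
        Finset.card_insert_of_notMem, Finset.card_insert_of_notMem, Finset.card_singleton]
      · simpa using hγα.symm
      · simp [hneαβ.symm, hγβ.symm]
      · simp [hneα.symm, hneβ.symm, hγθ.symm]
    have hall : ∀ δ : {α : Weight ℝ H L // 0 < α x}, δ = ⟨θ, hθ⟩ ∨ δ = β ∨ δ = α ∨ δ = γ := by
      intro δ
      have := Finset.mem_univ δ
      rw [← hu] at this
      simpa using this
    have key : ∀ α β : {α : Weight ℝ H L // 0 < α x}, (α.1 + β.1 : H → ℝ) = θ → α ≠ β →
        α ≠ ⟨θ, hθ⟩ → β ≠ ⟨θ, hθ⟩ → γ ≠ α → γ ≠ β →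
        (∀ δ : {α : Weight ℝ H L // 0 < α x}, δ = ⟨θ, hθ⟩ ∨ δ = β ∨ δ = α ∨ δ = γ) →
        ⁅B (.inr β), B (.inr γ)⁆ = 0 →
        (∃ d : ℝ, ⁅B (.inr α), B (.inr γ)⁆ = d • B (.inr β)) →
        AdmitsSymplectic (TrivialExtension s (posRootSubalgebra x)) := by
      intro α β hαβ hneαβ hneα hneβ hγα hγβ hall hβγ ⟨d, hd⟩
      obtain ⟨c, hc⟩ := hmul α β ⟨θ, hθ⟩ hαβ
      let f : Fin 4 → Fin s ⊕ {α : Weight ℝ H L // 0 < α x} :=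
        ![.inr ⟨θ, hθ⟩, .inr β, .inr α, .inr γ]
      have hf : Function.Injective f := by
        apply injective_vecCons_four <;>
          simp [hneα.symm, hneβ.symm, hneαβ.symm, hγα.symm, hγβ.symm, hγθ.symm]
      refine admitsSymplectic_of_basis B hcardB ⟨f, hf⟩ (c := c) (d := d) hc hd hβγ hθB ?_
      rintro (j | δ) hj l
      · exact hleft _ _
      · exfalso
        rcases hall δ with rfl | rfl | rfl | rfl
        · exact hj ⟨0, rfl⟩
        · exact hj ⟨1, rfl⟩
        · exact hj ⟨2, rfl⟩
        · exact hj ⟨3, rfl⟩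
    -- Of the four positive roots, `α + γ` can only be `β`: `θ` would give `γ = β`, and `α` or `γ`
    -- would make a positive root vanish at `x`.
    have hsum : ∀ α β : {α : Weight ℝ H L // 0 < α x}, (α.1 + β.1 : H → ℝ) = θ → γ ≠ β →
        (∀ δ : {α : Weight ℝ H L // 0 < α x}, δ = ⟨θ, hθ⟩ ∨ δ = β ∨ δ = α ∨ δ = γ) →
        ⁅B (.inr α), B (.inr γ)⁆ = 0 ∨ (α.1 + γ.1 : H → ℝ) = β.1 := by
      intro α β hαβ hγβ hall
      by_contra! h
      refine h.1 (hzero α γ fun δ hδ => ?_)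
      rcases hall δ with rfl | rfl | rfl | rfl
      · exact hγβ (Subtype.ext (DFunLike.coe_injective (add_left_cancel (hδ.trans hαβ.symm))))
      · exact h.2 hδ
      · have := congrFun hδ x
        have h5 := γ.2
        simp at this
        linarith
      · have := congrFun hδ x
        have h5 := α.2
        simp at this
        linarith
    have hβα : (β.1 + α.1 : H → ℝ) = θ := by rw [add_comm, hαβ]
    have hall' : ∀ δ : {α : Weight ℝ H L // 0 < α x},
        δ = ⟨θ, hθ⟩ ∨ δ = α ∨ δ = β ∨ δ = γ := fun δ => by
      rcases hall δ with h | h | h | h <;> simp [h]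
    -- The relations `β + γ = α` and `α + γ = β` exclude each other since `γ` is positive; exchange
    -- `α` and `β` if the first one holds.
    rcases hsum β α hβα hγα hall' with h | h
    · refine key α β hαβ hneαβ hneα hneβ hγα hγβ hall h ?_
      rcases hsum α β hαβ hγβ hall with h' | h'
      · exact ⟨0, by rw [h', zero_smul]⟩
      · exact hmul _ _ _ h'
    · refine key β α hβα hneαβ.symm hneβ hneα hγβ hγα hall' ?_ (hmul _ _ _ h)
      refine (hsum α β hαβ hγβ hall).resolve_right fun h' => ?_
      have h5 := congrFun h x
      have h6 := congrFun h' x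
      have h7 := γ.2
      simp only [Pi.add_apply] at h5 h6
      linarith

end Converse

end SplitSimple

section Classical

open LieAlgebra Module
open scoped Matrix

/-! ### Low-dimensional coincidences among classical algebras -/

section ClassicalIsomorphisms

open Complex Matrix

/-- As `J` is skew, skew-adjointness of `A` becomes symmetry of `J * A`. This yields both the block
shape of `A` and the dimension count. -/
theorem mem_sp_iff_isSymm {l : Type*} [Fintype l] [DecidableEq l]
    (A : Matrix (l ⊕ l) (l ⊕ l) ℂ) :
    A ∈ LieAlgebra.Symplectic.sp l ℂ ↔ (Matrix.J l ℂ * A)ᵀ = Matrix.J l ℂ * A := by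
  rw [LieAlgebra.Symplectic.sp, mem_skewAdjointMatricesLieSubalgebra,
    mem_skewAdjointMatricesSubmodule, Matrix.IsSkewAdjoint, Matrix.IsAdjointPair,
    Matrix.transpose_mul, Matrix.J_transpose, Matrix.mul_neg, Matrix.mul_neg, neg_eq_iff_eq_neg]

theorem sp_apply_inr_inr {l : Type*} [Fintype l] [DecidableEq l]
    (A : LieAlgebra.Symplectic.sp l ℂ) (i j : l) :
    A.1 (.inr i) (.inr j) = -A.1 (.inl j) (.inl i) := by
  have := congrFun (congrFun ((mem_sp_iff_isSymm A.1).mp A.2) (.inl i)) (.inr j)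
  simp only [Matrix.transpose_apply, Matrix.mul_apply, Matrix.J, Fintype.sum_sum_type,
    Matrix.fromBlocks_apply₁₁, Matrix.fromBlocks_apply₁₂, Matrix.fromBlocks_apply₂₁,
    Matrix.fromBlocks_apply₂₂] at this
  simp [Matrix.one_apply] at this
  rw [this, neg_neg]

theorem sp_apply_inl_inr {l : Type*} [Fintype l] [DecidableEq l]
    (A : LieAlgebra.Symplectic.sp l ℂ) (i j : l) :
    A.1 (.inl i) (.inr j) = A.1 (.inl j) (.inr i) := by
  have := congrFun (congrFun ((mem_sp_iff_isSymm A.1).mp A.2) (.inr i)) (.inr j)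
  simp only [Matrix.transpose_apply, Matrix.mul_apply, Matrix.J, Fintype.sum_sum_type,
    Matrix.fromBlocks_apply₂₁, Matrix.fromBlocks_apply₂₂] at this
  simp [Matrix.one_apply] at this
  exact this.symm

theorem sp_apply_inr_inl {l : Type*} [Fintype l] [DecidableEq l]
    (A : LieAlgebra.Symplectic.sp l ℂ) (i j : l) :
    A.1 (.inr i) (.inl j) = A.1 (.inr j) (.inl i) := by
  have := congrFun (congrFun ((mem_sp_iff_isSymm A.1).mp A.2) (.inl i)) (.inl j)
  simp only [Matrix.transpose_apply, Matrix.mul_apply, Matrix.J, Fintype.sum_sum_type,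
    Matrix.fromBlocks_apply₁₁, Matrix.fromBlocks_apply₁₂] at this
  simp [Matrix.one_apply] at this
  exact this.symm

/-- The skew-symmetric matrix of size five with the given entries above the diagonal. -/
def skewFive (x₀₁ x₀₂ x₀₃ x₀₄ x₁₂ x₁₃ x₁₄ x₂₃ x₂₄ x₃₄ : ℂ) : Matrix (Fin 5) (Fin 5) ℂ :=
  !![0, x₀₁, x₀₂, x₀₃, x₀₄; -x₀₁, 0, x₁₂, x₁₃, x₁₄; -x₀₂, -x₁₂, 0, x₂₃, x₂₄;
    -x₀₃, -x₁₃, -x₂₃, 0, x₃₄; -x₀₄, -x₁₄, -x₂₄, -x₃₄, 0]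

theorem skewFive_lie (x₀₁ x₀₂ x₀₃ x₀₄ x₁₂ x₁₃ x₁₄ x₂₃ x₂₄ x₃₄ y₀₁ y₀₂ y₀₃ y₀₄ y₁₂ y₁₃ y₁₄
    y₂₃ y₂₄ y₃₄ : ℂ) :
    skewFive x₀₁ x₀₂ x₀₃ x₀₄ x₁₂ x₁₃ x₁₄ x₂₃ x₂₄ x₃₄ *
      skewFive y₀₁ y₀₂ y₀₃ y₀₄ y₁₂ y₁₃ y₁₄ y₂₃ y₂₄ y₃₄ -
      skewFive y₀₁ y₀₂ y₀₃ y₀₄ y₁₂ y₁₃ y₁₄ y₂₃ y₂₄ y₃₄ *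
        skewFive x₀₁ x₀₂ x₀₃ x₀₄ x₁₂ x₁₃ x₁₄ x₂₃ x₂₄ x₃₄ =
    skewFive
      (-(x₀₂ * y₁₂) + y₀₂ * x₁₂ - x₀₃ * y₁₃ + y₀₃ * x₁₃ - x₀₄ * y₁₄ + y₀₄ * x₁₄)
      (x₀₁ * y₁₂ - y₀₁ * x₁₂ - x₀₃ * y₂₃ + y₀₃ * x₂₃ - x₀₄ * y₂₄ + y₀₄ * x₂₄)
      (x₀₁ * y₁₃ - y₀₁ * x₁₃ + x₀₂ * y₂₃ - y₀₂ * x₂₃ - x₀₄ * y₃₄ + y₀₄ * x₃₄)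
      (x₀₁ * y₁₄ - y₀₁ * x₁₄ + x₀₂ * y₂₄ - y₀₂ * x₂₄ + x₀₃ * y₃₄ - y₀₃ * x₃₄)
      (-(x₀₁ * y₀₂) + y₀₁ * x₀₂ - x₁₃ * y₂₃ + y₁₃ * x₂₃ - x₁₄ * y₂₄ + y₁₄ * x₂₄)
      (-(x₀₁ * y₀₃) + y₀₁ * x₀₃ + x₁₂ * y₂₃ - y₁₂ * x₂₃ - x₁₄ * y₃₄ + y₁₄ * x₃₄)
      (-(x₀₁ * y₀₄) + y₀₁ * x₀₄ + x₁₂ * y₂₄ - y₁₂ * x₂₄ + x₁₃ * y₃₄ - y₁₃ * x₃₄)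
      (-(x₀₂ * y₀₃) + y₀₂ * x₀₃ - x₁₂ * y₁₃ + y₁₂ * x₁₃ - x₂₄ * y₃₄ + y₂₄ * x₃₄)
      (-(x₀₂ * y₀₄) + y₀₂ * x₀₄ - x₁₂ * y₁₄ + y₁₂ * x₁₄ + x₂₃ * y₃₄ - y₂₃ * x₃₄)
      (-(x₀₃ * y₀₄) + y₀₃ * x₀₄ - x₁₃ * y₁₄ + y₁₃ * x₁₄ - x₂₃ * y₂₄ + y₂₃ * x₂₄) := by
  simp [skewFive]
  ring_nf
  simp only [and_self]

theorem skewFive_add (x₀₁ x₀₂ x₀₃ x₀₄ x₁₂ x₁₃ x₁₄ x₂₃ x₂₄ x₃₄ y₀₁ y₀₂ y₀₃ y₀₄ y₁₂ y₁₃ y₁₄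
    y₂₃ y₂₄ y₃₄ : ℂ) :
    skewFive x₀₁ x₀₂ x₀₃ x₀₄ x₁₂ x₁₃ x₁₄ x₂₃ x₂₄ x₃₄ +
      skewFive y₀₁ y₀₂ y₀₃ y₀₄ y₁₂ y₁₃ y₁₄ y₂₃ y₂₄ y₃₄ =
    skewFive (x₀₁ + y₀₁) (x₀₂ + y₀₂) (x₀₃ + y₀₃) (x₀₄ + y₀₄) (x₁₂ + y₁₂) (x₁₃ + y₁₃) (x₁₄ + y₁₄)
      (x₂₃ + y₂₃) (x₂₄ + y₂₄) (x₃₄ + y₃₄) := by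
  simp [skewFive, neg_add_rev, add_comm]

theorem smul_skewFive (t x₀₁ x₀₂ x₀₃ x₀₄ x₁₂ x₁₃ x₁₄ x₂₃ x₂₄ x₃₄ : ℂ) :
    t • skewFive x₀₁ x₀₂ x₀₃ x₀₄ x₁₂ x₁₃ x₁₄ x₂₃ x₂₄ x₃₄ =
    skewFive (t * x₀₁) (t * x₀₂) (t * x₀₃) (t * x₀₄) (t * x₁₂) (t * x₁₃) (t * x₁₄)
      (t * x₂₃) (t * x₂₄) (t * x₃₄) := by
  simp [skewFive]

theorem skewFive_mem_so (x₀₁ x₀₂ x₀₃ x₀₄ x₁₂ x₁₃ x₁₄ x₂₃ x₂₄ x₃₄ : ℂ) :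
    skewFive x₀₁ x₀₂ x₀₃ x₀₄ x₁₂ x₁₃ x₁₄ x₂₃ x₂₄ x₃₄ ∈ LieAlgebra.Orthogonal.so (Fin 5) ℂ := by
  rw [LieAlgebra.Orthogonal.mem_so]
  ext i j
  fin_cases i <;> fin_cases j <;> simp [skewFive]

/-- The action of `sp(4)` on the five-dimensional primitive part of the exterior square, in an
orthonormal basis. -/
noncomputable def spFourMatrix (a b c d p q r u v w : ℂ) : Matrix (Fin 5) (Fin 5) ℂ :=
  skewFive (I * (a + d)) ((r - p + u - w) / 2) (I * (r + p + u + w) / 2) (q - v)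
    (I * (p - r + u - w) / 2) ((r + p - u - w) / 2) (-I * (q + v)) (I * (a - d)) (c - b)
    (I * (b + c))

/-- The arguments on the left are the entries of a commutator of block matrices: `a b c d` is the
upper left block, `p q r` and `u v w` are the symmetric off-diagonal ones, and the lower right block
is minus the transpose of the first. -/
theorem spFourMatrix_lie (a b c d p q r u v w a' b' c' d' p' q' r' u' v' w' : ℂ) :
    spFourMatrix
      (a * a' + b * c' + p * u' + q * v' - (a' * a + b' * c + p' * u + q' * v))
      (a * b' + b * d' + p * v' + q * w' - (a' * b + b' * d + p' * v + q' * w))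
      (c * a' + d * c' + q * u' + r * v' - (c' * a + d' * c + q' * u + r' * v))
      (c * b' + d * d' + q * v' + r * w' - (c' * b + d' * d + q' * v + r' * w))
      (a * p' + b * q' + p * -a' + q * -b' - (a' * p + b' * q + p' * -a + q' * -b))
      (a * q' + b * r' + p * -c' + q * -d' - (a' * q + b' * r + p' * -c + q' * -d))
      (c * q' + d * r' + q * -c' + r * -d' - (c' * q + d' * r + q' * -c + r' * -d))
      (u * a' + v * c' + -a * u' + -c * v' - (u' * a + v' * c + -a' * u + -c' * v))
      (u * b' + v * d' + -a * v' + -c * w' - (u' * b + v' * d + -a' * v + -c' * w))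
      (v * b' + w * d' + -b * v' + -d * w' - (v' * b + w' * d + -b' * v + -d' * w)) =
    spFourMatrix a b c d p q r u v w * spFourMatrix a' b' c' d' p' q' r' u' v' w' -
      spFourMatrix a' b' c' d' p' q' r' u' v' w' * spFourMatrix a b c d p q r u v w := by
  rw [spFourMatrix, spFourMatrix, spFourMatrix, skewFive_lie]
  congr 1 <;> ring_nf <;> simp only [I_sq] <;> ring

/-- The matrix of `so(5)` attached to an element of `sp(4)`. -/
noncomputable def spFourFun (A : Matrix (Fin 2 ⊕ Fin 2) (Fin 2 ⊕ Fin 2) ℂ) :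
    Matrix (Fin 5) (Fin 5) ℂ :=
  spFourMatrix (A (.inl 0) (.inl 0)) (A (.inl 0) (.inl 1)) (A (.inl 1) (.inl 0))
    (A (.inl 1) (.inl 1)) (A (.inl 0) (.inr 0)) (A (.inl 0) (.inr 1)) (A (.inl 1) (.inr 1))
    (A (.inr 0) (.inl 0)) (A (.inr 0) (.inl 1)) (A (.inr 1) (.inl 1))

theorem spFourFun_add (A B : Matrix (Fin 2 ⊕ Fin 2) (Fin 2 ⊕ Fin 2) ℂ) :
    spFourFun (A + B) = spFourFun A + spFourFun B := by
  simp only [spFourFun, spFourMatrix, skewFive_add, Matrix.add_apply]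
  congr 1 <;> ring

theorem spFourFun_smul (t : ℂ) (A : Matrix (Fin 2 ⊕ Fin 2) (Fin 2 ⊕ Fin 2) ℂ) :
    spFourFun (t • A) = t • spFourFun A := by
  simp only [spFourFun, spFourMatrix, smul_skewFive, Matrix.smul_apply, smul_eq_mul]
  congr 1 <;> ring

theorem spFourFun_lie (A B : LieAlgebra.Symplectic.sp (Fin 2) ℂ) :
    spFourFun (A.1 * B.1 - B.1 * A.1) =
      spFourFun A.1 * spFourFun B.1 - spFourFun B.1 * spFourFun A.1 := by
  simp only [spFourFun]
  rw [← spFourMatrix_lie]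
  simp only [Matrix.sub_apply, Matrix.mul_apply, Fintype.sum_sum_type, Fin.sum_univ_two,
    sp_apply_inr_inr, sp_apply_inl_inr A 1 0, sp_apply_inl_inr B 1 0, sp_apply_inr_inl A 1 0,
    sp_apply_inr_inl B 1 0, ← add_assoc]

/-- The homomorphism from `sp(4)` to `so(5)`. -/
noncomputable def spFourHom :
    LieAlgebra.Symplectic.sp (Fin 2) ℂ →ₗ⁅ℂ⁆ LieAlgebra.Orthogonal.so (Fin 5) ℂ where
  toFun A := ⟨spFourFun A.1, skewFive_mem_so _ _ _ _ _ _ _ _ _ _⟩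
  map_add' A B := Subtype.ext (spFourFun_add A.1 B.1)
  map_smul' t A := Subtype.ext (spFourFun_smul t A.1)
  map_lie' {A B} := Subtype.ext (spFourFun_lie A B)

theorem spFourHom_injective : Function.Injective spFourHom := by
  rw [injective_iff_map_eq_zero]
  intro A hA
  have h : ∀ i j, spFourFun A.1 i j = 0 := fun i j =>
    congrFun (congrFun (congrArg Subtype.val hA) i) j
  have h01 := h 0 1
  have h02 := h 0 2
  have h03 := h 0 3
  have h04 := h 0 4
  have h12 := h 1 2
  have h13 := h 1 3
  have h14 := h 1 4
  have h23 := h 2 3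
  have h24 := h 2 4
  have h34 := h 3 4
  simp [spFourFun, spFourMatrix, skewFive] at h01 h02 h03 h04 h12 h13 h14 h23 h24 h34
  have h1 := sp_apply_inl_inr A 1 0
  have h2 := sp_apply_inr_inl A 1 0
  apply Subtype.ext
  ext i j
  rcases i with i | i <;> rcases j with j | j <;> fin_cases i <;> fin_cases j <;>
    simp [sp_apply_inr_inr, h1, h2] <;> grind

/-- The traceless matrices of size two act on themselves by rotations. -/
noncomputable def slTwoHom :
    LieAlgebra.SpecialLinear.sl (Fin 2) ℂ →ₗ⁅ℂ⁆ LieAlgebra.Orthogonal.so (Fin 3) ℂ where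
  toFun A := ⟨!![0, -(2 * I * A.1 0 0), A.1 1 0 - A.1 0 1;
      2 * I * A.1 0 0, 0, -(I * (A.1 0 1 + A.1 1 0));
      A.1 0 1 - A.1 1 0, I * (A.1 0 1 + A.1 1 0), 0], by
    rw [LieAlgebra.Orthogonal.mem_so]
    ext i j
    fin_cases i <;> fin_cases j <;> simp⟩
  map_add' A B := by
    apply Subtype.ext
    ext i j
    fin_cases i <;> fin_cases j <;> simp <;> ring
  map_smul' t A := by
    apply Subtype.ext
    ext i j
    fin_cases i <;> fin_cases j <;> simp <;> ring
  map_lie' {A B} := by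
    have hA : A.1 1 1 = -A.1 0 0 := by
      have : A.1.trace = 0 := A.2
      rw [Matrix.trace_fin_two] at this
      linear_combination this
    have hB : B.1 1 1 = -B.1 0 0 := by
      have : B.1.trace = 0 := B.2
      rw [Matrix.trace_fin_two] at this
      linear_combination this
    apply Subtype.ext
    ext i j
    fin_cases i <;> fin_cases j <;>
    simp [Ring.lie_def, Matrix.mul_apply, Fin.sum_univ_two, hA, hB] <;>
      ring_nf <;> simp only [I_sq] <;> ring

theorem slTwoHom_injective : Function.Injective slTwoHom := by
  rw [injective_iff_map_eq_zero]
  intro A hA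
  have h : ∀ i j, (slTwoHom A).1 i j = 0 := fun i j =>
    congrFun (congrFun (congrArg Subtype.val hA) i) j
  have h10 := h 1 0
  have h20 := h 2 0
  have h21 := h 2 1
  simp [slTwoHom] at h10 h20 h21
  have htr : A.1.trace = 0 := A.2
  rw [Matrix.trace_fin_two] at htr
  apply Subtype.ext
  ext i j
  fin_cases i <;> fin_cases j <;> simp <;> grind

set_option maxHeartbeats 400000 in
/-- The homomorphism from `sp(2)` to `sl(2)`. -/
noncomputable def spTwoHom :
    LieAlgebra.Symplectic.sp (Fin 1) ℂ →ₗ⁅ℂ⁆ LieAlgebra.SpecialLinear.sl (Fin 2) ℂ where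
  toFun A := ⟨!![A.1 (.inl 0) (.inl 0), A.1 (.inl 0) (.inr 0);
      A.1 (.inr 0) (.inl 0), -A.1 (.inl 0) (.inl 0)], by
    change Matrix.trace (n := Fin 2) (R := ℂ) _ = 0
    simp [Matrix.trace_fin_two]⟩
  map_add' A B := by
    apply Subtype.ext
    ext i j
    fin_cases i <;> fin_cases j <;> simp <;> ring
  map_smul' t A := by
    apply Subtype.ext
    ext i j
    fin_cases i <;> fin_cases j <;> simp
  map_lie' {A B} := by
    apply Subtype.ext
    ext i j
    fin_cases i <;> fin_cases j <;>
    simp [Ring.lie_def, Matrix.mul_apply, sp_apply_inr_inr]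
    ring

theorem spTwoHom_injective : Function.Injective spTwoHom := by
  rw [injective_iff_map_eq_zero]
  intro A hA
  have h : ∀ i j, (spTwoHom A).1 i j = 0 := fun i j =>
    congrFun (congrFun (congrArg Subtype.val hA) i) j
  have h00 := h 0 0
  have h01 := h 0 1
  have h10 := h 1 0
  simp [spTwoHom] at h00 h01 h10
  apply Subtype.ext
  ext i j
  rcases i with i | i <;> rcases j with j | j <;> fin_cases i <;> fin_cases j <;>
    simp [sp_apply_inr_inr, h00, h01, h10]

end ClassicalIsomorphisms

/-! ### Dimensions of the classical algebras -/

section Dimensions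

attribute [local instance] LieRing.ofAssociativeRing

/-- Rank-nullity for the trace. The size is `n + 1` because the trace is not onto for empty
matrices. -/
theorem finrank_sl_add_one (n : ℕ) :
    finrank ℂ (LieAlgebra.SpecialLinear.sl (Fin (n + 1)) ℂ) + 1 = (n + 1) ^ 2 := by
  have h := LinearMap.finrank_range_add_finrank_ker (Matrix.traceLinearMap (Fin (n + 1)) ℂ ℂ)
  have hr : LinearMap.range (Matrix.traceLinearMap (Fin (n + 1)) ℂ ℂ) = ⊤ := by
    rw [LinearMap.range_eq_top]
    intro c
    exact ⟨Matrix.single 0 0 c, by simp⟩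
  rw [hr, finrank_top, finrank_self, Module.finrank_matrix, finrank_self, Fintype.card_fin] at h
  have h' : finrank ℂ (LieAlgebra.SpecialLinear.sl (Fin (n + 1)) ℂ) =
    finrank ℂ (LinearMap.ker (Matrix.traceLinearMap (Fin (n + 1)) ℂ ℂ)) := rfl
  rw [h']
  linarith

/-- The space of symmetric complex matrices. -/
def symmMatrices (ι : Type*) : Submodule ℂ (Matrix ι ι ℂ) where
  carrier := {A | Aᵀ = A}
  add_mem' {A B} hA hB := by
    rw [Set.mem_ofPred_eq] at hA hB ⊢
    rw [Matrix.transpose_add, hA, hB]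
  zero_mem' := Matrix.transpose_zero
  smul_mem' t A hA := by
    rw [Set.mem_ofPred_eq] at hA ⊢
    rw [Matrix.transpose_smul, hA]

theorem mem_symmMatrices {ι : Type*} {A : Matrix ι ι ℂ} : A ∈ symmMatrices ι ↔ Aᵀ = A := Iff.rfl

/-- Symmetric matrices are functions on unordered pairs. -/
def symmMatricesEquiv (ι : Type*) : symmMatrices ι ≃ₗ[ℂ] (Sym2 ι → ℂ) where
  toFun A := Sym2.lift ⟨A.1, fun i j => congrFun (congrFun A.2 j) i⟩
  invFun f := ⟨Matrix.of fun i j => f s(i, j), by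
    ext i j
    simp [Sym2.eq_swap]⟩
  map_add' A B := by
    ext z
    induction z with | _ i j => rfl
  map_smul' t A := by
    ext z
    induction z with | _ i j => rfl
  left_inv A := rfl
  right_inv f := by
    ext z
    induction z with | _ i j => rfl

theorem finrank_symmMatrices (ι : Type*) [Fintype ι] [DecidableEq ι] :
    finrank ℂ (symmMatrices ι) = (Fintype.card ι + 1).choose 2 := by
  rw [(symmMatricesEquiv ι).finrank_eq, Module.finrank_fintype_fun_eq_card, Sym2.card]

theorem two_mul_finrank_symmMatrices (ι : Type*) [Fintype ι] [DecidableEq ι] :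
    2 * finrank ℂ (symmMatrices ι) = (Fintype.card ι + 1) * Fintype.card ι := by
  rw [finrank_symmMatrices, Nat.choose_two_right, Nat.add_sub_cancel, mul_comm 2]
  exact Nat.div_mul_cancel (by rw [mul_comm]; exact (Nat.even_mul_succ_self _).two_dvd)

/-- Rank-nullity for `A ↦ A - Aᵀ`, whose kernel is the symmetric and whose range the skew-symmetric
matrices. -/
theorem two_mul_finrank_so_add (n : ℕ) :
    2 * finrank ℂ (LieAlgebra.Orthogonal.so (Fin n) ℂ) + n = n ^ 2 := by
  let f : Matrix (Fin n) (Fin n) ℂ →ₗ[ℂ] Matrix (Fin n) (Fin n) ℂ :=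
    LinearMap.id - (Matrix.transposeLinearEquiv (Fin n) (Fin n) ℂ ℂ).toLinearMap
  have hf : ∀ A, f A = A - Aᵀ := fun A => rfl
  have h := LinearMap.finrank_range_add_finrank_ker f
  have hk : LinearMap.ker f = symmMatrices (Fin n) := by
    ext A
    rw [LinearMap.mem_ker, hf, sub_eq_zero, mem_symmMatrices, eq_comm]
  have hr : LinearMap.range f = (LieAlgebra.Orthogonal.so (Fin n) ℂ).toSubmodule := by
    ext A
    rw [LinearMap.mem_range, LieSubalgebra.mem_toSubmodule, LieAlgebra.Orthogonal.mem_so]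
    refine ⟨?_, fun hA => ⟨(1 / 2 : ℂ) • A, ?_⟩⟩
    · rintro ⟨B, rfl⟩
      rw [hf, Matrix.transpose_sub, Matrix.transpose_transpose, neg_sub]
    · rw [hf, Matrix.transpose_smul, hA, smul_neg, sub_neg_eq_add, ← add_smul]
      norm_num
  rw [hk, hr, Module.finrank_matrix, finrank_self, Fintype.card_fin] at h
  have hs := two_mul_finrank_symmMatrices (Fin n)
  rw [Fintype.card_fin] at hs
  have h' : finrank ℂ (LieAlgebra.Orthogonal.so (Fin n) ℂ) =
    finrank ℂ (LieAlgebra.Orthogonal.so (Fin n) ℂ).toSubmodule := rfl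
  rw [h']
  nlinarith

/-- Left multiplication by `J` is a bijection onto the symmetric matrices of size `2n`. -/
theorem finrank_sp (n : ℕ) :
    finrank ℂ (LieAlgebra.Symplectic.sp (Fin n) ℂ) = n * (2 * n + 1) := by
  let e : Matrix (Fin n ⊕ Fin n) (Fin n ⊕ Fin n) ℂ ≃ₗ[ℂ] Matrix (Fin n ⊕ Fin n) (Fin n ⊕ Fin n) ℂ :=
    LinearEquiv.ofLinearMap (LinearMap.mulLeft ℂ (Matrix.J (Fin n) ℂ))
      (LinearMap.mulLeft ℂ (-Matrix.J (Fin n) ℂ))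
      (by ext1 A; simp [← Matrix.mul_assoc, Matrix.J_squared])
      (by ext1 A; simp [← Matrix.mul_assoc, Matrix.J_squared])
  have h := (e.submoduleMap (LieAlgebra.Symplectic.sp (Fin n) ℂ).toSubmodule).finrank_eq
  have hm : (LieAlgebra.Symplectic.sp (Fin n) ℂ).toSubmodule.map
      (e : Matrix (Fin n ⊕ Fin n) (Fin n ⊕ Fin n) ℂ →ₗ[ℂ] Matrix (Fin n ⊕ Fin n) (Fin n ⊕ Fin n) ℂ) =
      symmMatrices (Fin n ⊕ Fin n) := by
    ext A
    rw [Submodule.mem_map_equiv, LieSubalgebra.mem_toSubmodule, mem_sp_iff_isSymm,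
      mem_symmMatrices]
    have : Matrix.J (Fin n) ℂ * e.symm A = A := e.apply_symm_apply A
    rw [this]
  rw [hm] at h
  have hs := two_mul_finrank_symmMatrices (Fin n ⊕ Fin n)
  rw [Fintype.card_sum, Fintype.card_fin] at hs
  have h' : finrank ℂ (LieAlgebra.Symplectic.sp (Fin n) ℂ) =
    finrank ℂ (LieAlgebra.Symplectic.sp (Fin n) ℂ).toSubmodule := rfl
  rw [h']
  nlinarith

end Dimensions

/-! ### Recognition by dimension -/

section Classification

theorem nonempty_lieEquiv_of_injective {A B : Type*} [LieRing A] [LieAlgebra ℂ A] [LieRing B]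
    [LieAlgebra ℂ B] [FiniteDimensional ℂ A] [FiniteDimensional ℂ B] (f : A →ₗ⁅ℂ⁆ B)
    (hf : Function.Injective f) (h : finrank ℂ A = finrank ℂ B) : Nonempty (A ≃ₗ⁅ℂ⁆ B) :=
  ⟨LieEquiv.ofBijective f ⟨hf,
    (LinearMap.injective_iff_surjective_of_finrank_eq_finrank (f := (f : A →ₗ[ℂ] B)) h).mp hf⟩⟩

theorem nonempty_sl_two_equiv_so_three :
    Nonempty (LieAlgebra.SpecialLinear.sl (Fin 2) ℂ ≃ₗ⁅ℂ⁆ LieAlgebra.Orthogonal.so (Fin 3) ℂ) :=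
  nonempty_lieEquiv_of_injective slTwoHom slTwoHom_injective (by
    have h1 : finrank ℂ (LieAlgebra.SpecialLinear.sl (Fin 2) ℂ) + 1 = 2 ^ 2 := finrank_sl_add_one 1
    have h2 := two_mul_finrank_so_add 3
    omega)

theorem nonempty_sp_two_equiv_sl_two :
    Nonempty (LieAlgebra.Symplectic.sp (Fin 1) ℂ ≃ₗ⁅ℂ⁆ LieAlgebra.SpecialLinear.sl (Fin 2) ℂ) :=
  nonempty_lieEquiv_of_injective spTwoHom spTwoHom_injective (by
    have h1 : finrank ℂ (LieAlgebra.SpecialLinear.sl (Fin 2) ℂ) + 1 = 2 ^ 2 := finrank_sl_add_one 1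
    have h2 := finrank_sp 1
    omega)

theorem nonempty_sp_four_equiv_so_five :
    Nonempty (LieAlgebra.Symplectic.sp (Fin 2) ℂ ≃ₗ⁅ℂ⁆ LieAlgebra.Orthogonal.so (Fin 5) ℂ) :=
  nonempty_lieEquiv_of_injective spFourHom spFourHom_injective (by
    have h1 := two_mul_finrank_so_add 5
    have h2 := finrank_sp 2
    omega)

/-- Among the classical simple Lie algebras, `sl(2)`, `sl(3)` and `so(5)` are those of dimension
`3`, `8` and `10`. -/
theorem IsClassicalSimple.finrank_iff {𝔤 : Type*} [LieRing 𝔤] [LieAlgebra ℂ 𝔤]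
    (h𝔤 : IsClassicalSimple 𝔤) :
    (finrank ℂ 𝔤 = 3 ∨ finrank ℂ 𝔤 = 8 ∨ finrank ℂ 𝔤 = 10) ↔
      (Nonempty (𝔤 ≃ₗ⁅ℂ⁆ LieAlgebra.SpecialLinear.sl (Fin 2) ℂ) ∨
        Nonempty (𝔤 ≃ₗ⁅ℂ⁆ LieAlgebra.SpecialLinear.sl (Fin 3) ℂ) ∨
        Nonempty (𝔤 ≃ₗ⁅ℂ⁆ LieAlgebra.Orthogonal.so (Fin 5) ℂ)) := by
  constructor
  · intro h
    rcases h𝔤.2 with ⟨n, ⟨e⟩⟩ | ⟨n, ⟨e⟩⟩ | ⟨n, ⟨e⟩⟩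
    · have he := e.toLinearEquiv.finrank_eq
      rcases n with _ | n
      · have : finrank ℂ (LieAlgebra.SpecialLinear.sl (Fin 0) ℂ) = 0 := finrank_zero_of_subsingleton
        omega
      · have hd := finrank_sl_add_one n
        have hn : n ≤ 3 := by
          by_contra hn
          push Not at hn
          have : finrank ℂ 𝔤 ≤ 10 := by omega
          nlinarith
        -- The dimensions are 0, 3, 8, 15, for matrices of size `n + 1`.
        interval_cases n
        · omega
        · exact Or.inl ⟨e⟩
        · exact Or.inr (Or.inl ⟨e⟩)
        · omega
    · have he := e.toLinearEquiv.finrank_eq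
      have hd := two_mul_finrank_so_add n
      have hn : n ≤ 5 := by
        by_contra hn
        push Not at hn
        have : finrank ℂ 𝔤 ≤ 10 := by omega
        nlinarith
      -- The dimensions are 0, 0, 1, 3, 6, 10.
      interval_cases n
      · omega
      · omega
      · omega
      · exact Or.inl (nonempty_sl_two_equiv_so_three.map fun f => e.trans f.symm)
      · omega
      · exact Or.inr (Or.inr ⟨e⟩)
    · have he := e.toLinearEquiv.finrank_eq
      have hd := finrank_sp n
      have hn : n ≤ 2 := by
        by_contra hn
        push Not at hn
        have : finrank ℂ 𝔤 ≤ 10 := by omega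
        nlinarith
      -- The dimensions are 0, 3, 10.
      interval_cases n
      · omega
      · exact Or.inl (nonempty_sp_two_equiv_sl_two.map fun f => e.trans f)
      · exact Or.inr (Or.inr (nonempty_sp_four_equiv_so_five.map fun f => e.trans f))
  · rintro (⟨⟨e⟩⟩ | ⟨⟨e⟩⟩ | ⟨⟨e⟩⟩)
    · have := e.toLinearEquiv.finrank_eq
      have : finrank ℂ (LieAlgebra.SpecialLinear.sl (Fin 2) ℂ) + 1 = 2 ^ 2 := finrank_sl_add_one 1
      omega
    · have := e.toLinearEquiv.finrank_eq
      have : finrank ℂ (LieAlgebra.SpecialLinear.sl (Fin 3) ℂ) + 1 = 3 ^ 2 := finrank_sl_add_one 2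
      omega
    · have := e.toLinearEquiv.finrank_eq
      have := two_mul_finrank_so_add 5
      omega

end Classification

/-! ### Simplicity of real forms -/

section RealForms

/-- A real Lie algebra with simple complexification is simple. -/
theorem isSimple_of_complexification {L 𝔤 : Type*} [LieRing L] [LieAlgebra ℝ L] [LieRing 𝔤]
    [LieAlgebra ℂ 𝔤] [LieAlgebra.IsSimple ℂ 𝔤] (e : (ℂ ⊗[ℝ] L) ≃ₗ⁅ℂ⁆ 𝔤) :
    LieAlgebra.IsSimple ℝ L where
  eq_bot_or_eq_top I := by
    -- The complexified ideal is transported to `𝔤` and is trivial there; base change to `ℂ` is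
    -- injective on subspaces, so `I` is trivial as well.
    have key : I.baseChange ℂ = ⊥ ∨ I.baseChange ℂ = (⊤ : LieIdeal ℂ (ℂ ⊗[ℝ] L)) := by
      let J : LieIdeal ℂ (ℂ ⊗[ℝ] L) := I.baseChange ℂ
      rcases LieAlgebra.IsSimple.eq_bot_or_eq_top (R := ℂ)
        (J.comap (e.symm : 𝔤 →ₗ⁅ℂ⁆ ℂ ⊗[ℝ] L)) with h | h
      · left
        rw [LieSubmodule.eq_bot_iff]
        intro z hz
        have hz' : e z ∈ J.comap (e.symm : 𝔤 →ₗ⁅ℂ⁆ ℂ ⊗[ℝ] L) := by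
          rw [LieIdeal.mem_comap]
          simpa using hz
        rw [h, LieSubmodule.mem_bot] at hz'
        simpa using hz'
      · right
        rw [eq_top_iff]
        intro z _
        have hz' : e z ∈ J.comap (e.symm : 𝔤 →ₗ⁅ℂ⁆ ℂ ⊗[ℝ] L) := by
          rw [h]
          exact LieSubmodule.mem_top _
        rw [LieIdeal.mem_comap] at hz'
        simpa using hz'
    rcases key with h | h
    · left
      rw [← LieSubmodule.toSubmodule_inj]
      apply Submodule.baseChange_injective (A := ℂ)
      rw [← LieSubmodule.coe_baseChange, h, LieSubmodule.bot_toSubmodule,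
        LieSubmodule.bot_toSubmodule, Submodule.baseChange_bot]
    · right
      rw [← LieSubmodule.toSubmodule_inj]
      apply Submodule.baseChange_injective (A := ℂ)
      rw [← LieSubmodule.coe_baseChange, h, LieSubmodule.top_toSubmodule,
        LieSubmodule.top_toSubmodule, Submodule.baseChange_top]
  non_abelian h := by
    refine LieAlgebra.IsSimple.non_abelian (R := ℂ) (L := 𝔤) ⟨fun a b => ?_⟩
    have hz : ∀ y z : ℂ ⊗[ℝ] L, ⁅y, z⁆ = 0 := by
      intro y z
      induction y with
      | zero => exact zero_lie _
      | add y₁ y₂ h₁ h₂ => rw [add_lie, h₁, h₂, add_zero]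
      | tmul s u =>
        induction z with
        | zero => exact lie_zero (L := ℂ ⊗[ℝ] L) (M := ℂ ⊗[ℝ] L) _
        | add z₁ z₂ h₁ h₂ =>
          exact (lie_add (L := ℂ ⊗[ℝ] L) (M := ℂ ⊗[ℝ] L) _ _ _).trans (by rw [h₁, h₂, add_zero])
        | tmul t v =>
          rw [LieAlgebra.ExtendScalars.bracket_tmul, trivial_lie_zero, TensorProduct.tmul_zero]
    rw [← e.apply_symm_apply a, ← e.apply_symm_apply b, ← e.map_lie, hz]
    exact map_zero e.toLinearEquiv

end RealForms

end Classical

/-! ### The main theorem -/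

theorem theorem4p1
    {𝔤 : Type*} [LieRing 𝔤] [LieAlgebra ℂ 𝔤] (h𝔤 : IsClassicalSimple 𝔤)
    {𝔤₀ : Type*} [LieRing 𝔤₀] [LieAlgebra ℝ 𝔤₀] [FiniteDimensional ℝ 𝔤₀]
    (h𝔤₀ : IsSplitRealForm 𝔤₀ 𝔤)
    (𝔭 : LieSubalgebra ℝ 𝔤₀) (h𝔭 : IsMinimalParabolic 𝔭)
    (s : ℕ) (hs : Even (Module.finrank ℝ (TrivialExtension s (lieNilradical 𝔭)))) :
    AdmitsSymplectic (TrivialExtension s (lieNilradical 𝔭)) ↔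
      (Nonempty (𝔤 ≃ₗ⁅ℂ⁆ LieAlgebra.SpecialLinear.sl (Fin 2) ℂ) ∨
        Nonempty (𝔤 ≃ₗ⁅ℂ⁆ LieAlgebra.SpecialLinear.sl (Fin 3) ℂ) ∨
        Nonempty (𝔤 ≃ₗ⁅ℂ⁆ LieAlgebra.Orthogonal.so (Fin 5) ℂ)) := by
  obtain ⟨⟨e⟩, -⟩ := h𝔤₀
  have := h𝔤.1
  have := isSimple_of_complexification e
  have := LieAlgebra.IsSimple.nontrivial ℝ 𝔤₀
  obtain ⟨𝔥, h, x, hx, hp⟩ := h𝔭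
  have := h.cartan
  have := h.split
  obtain ⟨f⟩ := nonempty_lieNilradical_equiv_posRootSubalgebra hx hp
  have F := trivialExtensionCongr s f
  have hdim : Module.finrank ℂ 𝔤 = Module.finrank ℝ 𝔤₀ := by
    rw [← e.toLinearEquiv.finrank_eq, Module.finrank_baseChange]
  have hcount := finrank_eq_finrank_add_two_mul_card hx
  -- Both sides now concern the number `r + 2N`: the pairs `(1, 1)`, `(2, 3)`, `(2, 4)` for `(r, N)`
  -- give 3, 8, 10.
  rw [← h𝔤.finrank_iff, hdim]
  constructor
  · intro H
    have := rank_and_card_of_admitsSymplectic hx (H.of_equiv F)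
    omega
  · intro H
    have heven : Even (Module.finrank ℝ (TrivialExtension s (posRootSubalgebra x))) := by
      rwa [← F.toLinearEquiv.finrank_eq]
    exact (admitsSymplectic_of_card hx heven
      (posRoots_card_eq_one_or_three_or_four hx H)).of_equiv F.symm
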